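/- Let $d_1,d_2\ge 1$ be integers, let $G_1\subset\mathbb R^{d_1}$ and $G_2\subset\mathbb R^{d_2}$ be bounded open sets with $0\in\overline{G_2}$, and for $\varepsilon>0$ set $G_\varepsilon=G_1\times\varepsilon G_2$, $G_0=G_1\times\{0\}$ (identified with $G_1$). Write $x=(\overline x,z)\in\mathbb R^{d_1}\times\mathbb R^{d_2}$. All spaces are real and all domains carry Lebesgue measure. Let $\mathcal A$ be an algebra with mean value on $\mathbb R^{d_1}$: a closed subalgebra of the bounded uniformly continuous functions $\mathrm{BUC}(\mathbb R^{d_1})$ that contains the constants, is translation invariant, and is such that for every $a\in\mathcal A$ the functions $x\mapsto a(x/\varepsilon)$ converge weakly-$*$ in $L^\infty(\mathbb R^{d_1})$, as $\varepsilon\to0^+$, to a constant $M(a)$. No separability or ergodicity of $\mathcal A$ is assumed. For a Banach space $\mathbb F$, let $\mathcal A(\mathbb R^{d_1};\mathbb F)$ be the closure in $\mathrm{BUC}(\mathbb R^{d_1};\mathbb F)$ (sup norm) of the finite sums $\sum a_i\otimes v_i$ with $a_i\in\mathcal A$, $v_i\in\mathbb F$. For $1\le r<\infty$, let $B^r_{\mathcal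 A}(\mathbb R^{d_1};\mathbb F)$ be the closure of $\mathcal A(\mathbb R^{d_1};\mathbb F)$, for the seminorm $$\|v\|_r=\Big(\limsup_{R\to\infty}\frac1{|B_R|}\int_{B_R}\|v(y)\|_{\mathbb F}^r\,dy\Big)^{1/r},$$ in the space of those $v\in L^r_{loc}(\mathbb R^{d_1};\mathbb F)$ with $\|v\|_r<\infty$, and let $\mathcal B^r_{\mathcal A}(\mathbb R^{d_1};\mathbb F)$ be the quotient of $B^r_{\mathcal A}(\mathbb R^{d_1};\mathbb F)$ by the subspace $\{\|v\|_r=0\}$, normed by $\|\cdot\|_r$. Let $1<p<\infty$ and $1/p'=1-1/p$. For $v\in\mathcal B^p_{\mathcal A}(\mathbb R^{d_1};L^p(G_2))$ and $g\in\mathcal A(\mathbb R^{d_1};L^{p'}(G_2))$ let $M(vg)\in L^1(G_2)$, also written $\zeta\mapsto M(v(\cdot,\zeta)g(\cdot,\zeta))$, denote the mean value $\lim_{R\to\infty}|B_R|^{-1}\int_{B_R}v(y,\cdot)g(y,\cdot)\,dy$, the limit being taken in $L^1(G_2)$; it exists and does not depend on the representative of $v$. **Theorem.** Let $(\varepsilon_n)$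 be a sequence of positive real numbers tending to $0$, let $u_n\in L^p(G_{\varepsilon_n})$, and suppose that there is a constant $C$ with $$\varepsilon_n^{-d_2/p}\,\|u_n\|_{L^p(G_{\varepsilon_n})}\le C\qquad\text{for all }n.$$ Then there are a strictly increasing sequence of indices $(n_k)$ and a function $u_0\in L^p(G_0;\mathcal B^p_{\mathcal A}(\mathbb R^{d_1};L^p(G_2)))$ such that, for every $f\in L^{p'}(G_0;\mathcal A(\mathbb R^{d_1};L^{p'}(G_2)))$, as $k\to\infty$ and with $\varepsilon=\varepsilon_{n_k}$, $$\varepsilon^{-d_2}\int_{G_{\varepsilon}}u_{n_k}(x)\,f\Big(\overline x,\frac{x}{\varepsilon}\Big)\,dx\;\longrightarrow\;\int_{G_0}\int_{G_2}M\big(u_0(\overline x,\cdot,\zeta)\,f(\overline x,\cdot,\zeta)\big)\,d\zeta\,d\overline x ,$$ where $f(\overline x,x/\varepsilon)=f(\overline x,\overline x/\varepsilon,z/\varepsilon)$. -/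

import Mathlib

open MeasureTheory Filter Topology Metric
open scoped ENNReal Pointwise BoundedContinuousFunction

noncomputable section

namespace ThinSigma

/-- Euclidean space of dimension `m`. -/
abbrev Euc (m : ℕ) : Type := EuclideanSpace ℝ (Fin m)

/-! ### Algebras with mean value -/

/-- `A` is an algebra with mean value on `ℝ^m`: a closed subalgebra (it contains the constants) of
the bounded uniformly continuous real functions, translation invariant, and such that for every
`u ∈ A` the functions `x ↦ u (x / ε)` converge weakly-* in `L^∞(ℝ^m)`, as `ε → 0⁺`, to a real
constant. -/
structure IsAlgebraWithMeanValue {m : ℕ} (A : Subalgebra ℝ (Euc m →ᵇ ℝ)) : Prop where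
  isClosed : IsClosed (A : Set (Euc m →ᵇ ℝ))
  uniformContinuous : ∀ u ∈ A, UniformContinuous u
  translate_mem : ∀ u ∈ A, ∀ a : Euc m, ∃ v ∈ A, ∀ y, v y = u (y + a)
  mean_value : ∀ u ∈ A, ∃ M : ℝ, ∀ φ : Euc m → ℝ, Integrable φ →
    Tendsto (fun ε : ℝ => ∫ x, u (ε⁻¹ • x) * φ x) (𝓝[>] 0) (𝓝 (M * ∫ x, φ x))

/-- The vector-valued algebra `A(ℝ^m; F)`: the closure, for the sup norm, of the space `A ⊗ F` of
finite sums of functions `y ↦ a(y) v` with `a ∈ A`, `v ∈ F`. (The bounded uniformly continuous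
functions are closed in the bounded continuous ones, so that it does not matter in which of the two
spaces the closure is taken.) It carries the sup norm. -/
def vecAlgebra {m : ℕ} (A : Subalgebra ℝ (Euc m →ᵇ ℝ)) (F : Type*) [NormedAddCommGroup F]
    [NormedSpace ℝ F] : Submodule ℝ (Euc m →ᵇ F) :=
  (Submodule.span ℝ {g : Euc m →ᵇ F | ∃ a ∈ A, ∃ v : F, ∀ y, g y = a y • v}).topologicalClosure

/-! ### Marcinkiewicz and Besicovitch spaces -/

/-- Normalized Lebesgue measure on the ball `B_R`, so that `∫ y, u y ∂(ballMean m R)` is the average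
of `u` over `B_R`. -/
def ballMean (m : ℕ) (R : ℝ) : Measure (Euc m) :=
  (volume (ball (0 : Euc m) R))⁻¹ • volume.restrict (ball 0 R)

/-- The seminorm `limsup_{R → ∞} (|B_R|⁻¹ ∫_{B_R} ‖u‖^p)^{1/p}`, with values in `[0, ∞]`. -/
def besSeminorm {m : ℕ} {F : Type*} [NormedAddCommGroup F] (p : ℝ≥0∞) (u : Euc m → F) : ℝ≥0∞ :=
  limsup (fun R : ℝ => eLpNorm u p (ballMean m R)) atTop

lemma isProbabilityMeasure_ballMean {m : ℕ} {R : ℝ} (hR : 0 < R) :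
    IsProbabilityMeasure (ballMean m R) := by
  constructor
  rw [ballMean, Measure.smul_apply, Measure.restrict_apply_univ, smul_eq_mul]
  exact ENNReal.inv_mul_cancel (measure_ball_pos _ _ hR).ne' measure_ball_lt_top.ne

lemma memLp_ballMean {m : ℕ} {F : Type*} [NormedAddCommGroup F] {p : ℝ≥0∞} {u : Euc m → F} {R : ℝ}
    (hR : 0 < R) (hu : MemLp u p (volume.restrict (ball 0 R))) : MemLp u p (ballMean m R) :=
  hu.smul_measure (ENNReal.inv_ne_top.2 (measure_ball_pos _ _ hR).ne')

lemma besSeminorm_add_le {m : ℕ} {F : Type*} [NormedAddCommGroup F] {p : ℝ≥0∞} (hp : 1 ≤ p)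
    {u v : Euc m → F} (hu : ∀ R, MemLp u p (volume.restrict (ball 0 R)))
    (hv : ∀ R, MemLp v p (volume.restrict (ball 0 R))) :
    besSeminorm p (u + v) ≤ besSeminorm p u + besSeminorm p v := by
  by_cases h1 : besSeminorm p u = ∞
  · simp [h1]
  by_cases h2 : besSeminorm p v = ∞
  · simp [h2]
  refine ENNReal.le_of_forall_pos_le_add fun δ hδ _ => ?_
  have hδ' : (δ / 2 : ℝ≥0∞) ≠ 0 := by
    simpa using hδ.ne'
  have e1 : ∀ᶠ R : ℝ in atTop, eLpNorm u p (ballMean m R) < besSeminorm p u + δ / 2 :=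
    eventually_lt_of_limsup_lt (ENNReal.lt_add_right h1 hδ')
  have e2 : ∀ᶠ R : ℝ in atTop, eLpNorm v p (ballMean m R) < besSeminorm p v + δ / 2 :=
    eventually_lt_of_limsup_lt (ENNReal.lt_add_right h2 hδ')
  refine limsup_le_of_le (by isBoundedDefault) ?_
  filter_upwards [e1, e2, eventually_gt_atTop 0] with R h1 h2 hR
  calc eLpNorm (u + v) p (ballMean m R)
      ≤ eLpNorm u p (ballMean m R) + eLpNorm v p (ballMean m R) :=
        eLpNorm_add_le (memLp_ballMean hR (hu R)).1 (memLp_ballMean hR (hv R)).1 hp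
    _ ≤ (besSeminorm p u + δ / 2) + (besSeminorm p v + δ / 2) := add_le_add h1.le h2.le
    _ = besSeminorm p u + besSeminorm p v + δ := by
        rw [add_add_add_comm, ENNReal.add_halves]

lemma besSeminorm_smul {m : ℕ} {F : Type*} [NormedAddCommGroup F] [NormedSpace ℝ F] {p : ℝ≥0∞}
    (c : ℝ) (u : Euc m → F) : besSeminorm p (c • u) = ‖c‖ₑ * besSeminorm p u := by
  simp only [besSeminorm, eLpNorm_const_smul]
  exact ENNReal.limsup_const_mul_of_ne_top enorm_ne_top

lemma besSeminorm_zero {m : ℕ} {F : Type*} [NormedAddCommGroup F] {p : ℝ≥0∞} :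
    besSeminorm p (0 : Euc m → F) = 0 := by
  simp [besSeminorm]

/-- The Marcinkiewicz functions: `u` is locally `p`-integrable and its seminorm is finite. -/
def marcinkiewiczSubmodule (m : ℕ) (p : ℝ≥0∞) [hp : Fact (1 ≤ p)] (F : Type*) [NormedAddCommGroup F]
    [NormedSpace ℝ F] : Submodule ℝ (Euc m → F) where
  carrier := {u | (∀ R, MemLp u p (volume.restrict (ball 0 R))) ∧ besSeminorm p u < ∞}
  zero_mem' := ⟨fun _ => MemLp.zero, by simp [besSeminorm_zero]⟩
  add_mem' := fun hu hv => ⟨fun R => (hu.1 R).add (hv.1 R),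
    (besSeminorm_add_le hp.out hu.1 hv.1).trans_lt (ENNReal.add_lt_top.2 ⟨hu.2, hv.2⟩)⟩
  smul_mem' := fun c u hu => ⟨fun R => (hu.1 R).const_smul c, by
    rw [besSeminorm_smul]; exact ENNReal.mul_lt_top enorm_lt_top hu.2⟩

/-- The Marcinkiewicz space `𝔐^p(ℝ^m; F)`, a seminormed space. (It is a type of its own so that it
does not inherit the topology of pointwise convergence.) -/
def Marcinkiewicz (m : ℕ) (p : ℝ≥0∞) [Fact (1 ≤ p)] (F : Type*) [NormedAddCommGroup F]
    [NormedSpace ℝ F] : Type _ := marcinkiewiczSubmodule m p F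

section

variable {m : ℕ} {p : ℝ≥0∞} [hp : Fact (1 ≤ p)] {F : Type*} [NormedAddCommGroup F] [NormedSpace ℝ F]

instance : AddCommGroup (Marcinkiewicz m p F) :=
  inferInstanceAs (AddCommGroup (marcinkiewiczSubmodule m p F))

instance : Module ℝ (Marcinkiewicz m p F) :=
  inferInstanceAs (Module ℝ (marcinkiewiczSubmodule m p F))

/-- The function underlying an element of the Marcinkiewicz space. -/
def Marcinkiewicz.fn (u : Marcinkiewicz m p F) : Euc m → F := u.1

lemma Marcinkiewicz.fn_add (u v : Marcinkiewicz m p F) : (u + v).fn = u.fn + v.fn := rfl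

lemma Marcinkiewicz.fn_sub (u v : Marcinkiewicz m p F) : (u - v).fn = u.fn - v.fn := rfl

lemma Marcinkiewicz.fn_smul (c : ℝ) (u : Marcinkiewicz m p F) : (c • u).fn = c • u.fn := rfl

lemma Marcinkiewicz.memLp (u : Marcinkiewicz m p F) (R : ℝ) :
    MemLp u.fn p (volume.restrict (ball 0 R)) := u.2.1 R

lemma Marcinkiewicz.besSeminorm_lt_top (u : Marcinkiewicz m p F) : besSeminorm p u.fn < ∞ := u.2.2

instance : Norm (Marcinkiewicz m p F) := ⟨fun u => (besSeminorm p u.fn).toReal⟩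

lemma Marcinkiewicz.norm_def (u : Marcinkiewicz m p F) : ‖u‖ = (besSeminorm p u.fn).toReal := rfl

lemma Marcinkiewicz.core : SeminormedSpace.Core ℝ (Marcinkiewicz m p F) where
  norm_nonneg _ := ENNReal.toReal_nonneg
  norm_smul c u := by
    rw [norm_def, norm_def, fn_smul, besSeminorm_smul, ENNReal.toReal_mul, toReal_enorm]
  norm_triangle u v := by
    rw [norm_def, norm_def, norm_def, fn_add,
      ← ENNReal.toReal_add u.besSeminorm_lt_top.ne v.besSeminorm_lt_top.ne]
    exact ENNReal.toReal_mono
      (ENNReal.add_lt_top.2 ⟨u.besSeminorm_lt_top, v.besSeminorm_lt_top⟩).ne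
      (besSeminorm_add_le hp.out u.memLp v.memLp)

instance : SeminormedAddCommGroup (Marcinkiewicz m p F) :=
  SeminormedAddCommGroup.ofCore Marcinkiewicz.core

instance : NormedSpace ℝ (Marcinkiewicz m p F) where
  norm_smul_le c u := (Marcinkiewicz.core.norm_smul c u).le

lemma bcf_mem_marcinkiewicz (g : Euc m →ᵇ F) : (g : Euc m → F) ∈ marcinkiewiczSubmodule m p F := by
  have hb : ∀ R : ℝ, MemLp (g : Euc m → F) p (volume.restrict (ball 0 R)) := fun R => by
    have : IsFiniteMeasure (volume.restrict (ball (0 : Euc m) R)) :=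
      ⟨by rw [Measure.restrict_apply_univ]; exact measure_ball_lt_top⟩
    exact MemLp.of_bound g.continuous.aestronglyMeasurable ‖g‖
      (Eventually.of_forall g.norm_coe_le_norm)
  refine ⟨hb, lt_of_le_of_lt (b := ENNReal.ofReal ‖g‖) ?_ ENNReal.ofReal_lt_top⟩
  refine limsup_le_of_le (by isBoundedDefault) ?_
  filter_upwards [eventually_gt_atTop 0] with R hR
  have := isProbabilityMeasure_ballMean (m := m) hR
  refine (eLpNorm_le_of_ae_bound (C := ‖g‖) (Eventually.of_forall g.norm_coe_le_norm)).trans ?_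
  simp

/-- Bounded continuous functions as elements of the Marcinkiewicz space. -/
def ofBCF : (Euc m →ᵇ F) →ₗ[ℝ] Marcinkiewicz m p F where
  toFun g := ⟨g, bcf_mem_marcinkiewicz g⟩
  map_add' _ _ := rfl
  map_smul' _ _ := rfl

end

/-- The generalized Besicovitch space `B_A^p(ℝ^m; F)`: the closure of `A(ℝ^m; F)` in the
Marcinkiewicz space. -/
def besicovitchSubmodule {m : ℕ} (A : Subalgebra ℝ (Euc m →ᵇ ℝ)) (p : ℝ≥0∞) [Fact (1 ≤ p)]
    (F : Type*) [NormedAddCommGroup F] [NormedSpace ℝ F] : Submodule ℝ (Marcinkiewicz m p F) :=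
  ((vecAlgebra A F).map ofBCF).topologicalClosure

/-- The normed space `𝓑_A^p(ℝ^m; F) = B_A^p(ℝ^m; F) / 𝒩`, where `𝒩` is the set of elements of
seminorm zero. -/
def Besicovitch {m : ℕ} (A : Subalgebra ℝ (Euc m →ᵇ ℝ)) (p : ℝ≥0∞) [Fact (1 ≤ p)]
    (F : Type*) [NormedAddCommGroup F] [NormedSpace ℝ F] : Type _ :=
  SeparationQuotient (besicovitchSubmodule A p F)

instance {m : ℕ} (A : Subalgebra ℝ (Euc m →ᵇ ℝ)) (p : ℝ≥0∞) [Fact (1 ≤ p)]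
    (F : Type*) [NormedAddCommGroup F] [NormedSpace ℝ F] :
    NormedAddCommGroup (Besicovitch A p F) :=
  inferInstanceAs (NormedAddCommGroup (SeparationQuotient (besicovitchSubmodule A p F)))

instance {m : ℕ} (A : Subalgebra ℝ (Euc m →ᵇ ℝ)) (p : ℝ≥0∞) [Fact (1 ≤ p)]
    (F : Type*) [NormedAddCommGroup F] [NormedSpace ℝ F] :
    NormedSpace ℝ (Besicovitch A p F) :=
  inferInstanceAs (NormedSpace ℝ (SeparationQuotient (besicovitchSubmodule A p F)))

/-! ### The mean value -/

/-- The average of `w` over the ball `B_R`. -/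
def ballAverage {m : ℕ} {F : Type*} [NormedAddCommGroup F] [NormedSpace ℝ F] (w : Euc m → F)
    (R : ℝ) : F := ∫ y, w y ∂(ballMean m R)

/-- The mean value `M(w) = lim_{R → ∞} |B_R|⁻¹ ∫_{B_R} w`. -/
def meanValue {m : ℕ} {F : Type*} [NormedAddCommGroup F] [NormedSpace ℝ F] (w : Euc m → F) : F :=
  limUnder atTop (ballAverage w)

section

variable {m : ℕ} {F F₁ F₂ : Type*} [NormedAddCommGroup F] [NormedSpace ℝ F]
  [NormedAddCommGroup F₁] [NormedSpace ℝ F₁] [NormedAddCommGroup F₂] [NormedSpace ℝ F₂]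

lemma isFiniteMeasure_restrict_ball (R : ℝ) :
    IsFiniteMeasure (volume.restrict (ball (0 : Euc m) R)) :=
  ⟨by rw [Measure.restrict_apply_univ]; exact measure_ball_lt_top⟩

lemma integrable_ballMean_of_memLp {m : ℕ} {F : Type*} [NormedAddCommGroup F] {p : ℝ≥0∞}
    (hp : 1 ≤ p) {w : Euc m → F} {R : ℝ} (hR : 0 < R)
    (hw : MemLp w p (volume.restrict (ball 0 R))) : Integrable w (ballMean m R) := by
  have := isProbabilityMeasure_ballMean (m := m) hR
  exact (memLp_ballMean hR hw).integrable hp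

lemma integrable_ballMean_bcf {m : ℕ} {F : Type*} [NormedAddCommGroup F] (g : Euc m →ᵇ F) {R : ℝ} (hR : 0 < R) :
    Integrable g (ballMean m R) := by
  have := isProbabilityMeasure_ballMean (m := m) hR
  exact Integrable.of_bound g.continuous.aestronglyMeasurable ‖g‖
    (Eventually.of_forall g.norm_coe_le_norm)

/-- Product of a locally `p`-integrable function and a bounded continuous one, through a bilinear
map. -/
lemma integrable_bilin (T : F₁ →L[ℝ] F₂ →L[ℝ] F) {u : Euc m → F₁} {R : ℝ}
    (hu : Integrable u (ballMean m R)) (f : Euc m →ᵇ F₂) :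
    Integrable (fun y => T (u y) (f y)) (ballMean m R) :=
  T.integrable_of_bilin_of_bdd_right ‖f‖ hu f.continuous.aestronglyMeasurable
    (Eventually.of_forall f.norm_coe_le_norm)

lemma norm_ballAverage_sub_le {w w' : Euc m → F} {k : Euc m → ℝ} {R : ℝ}
    (hw : Integrable w (ballMean m R)) (hw' : Integrable w' (ballMean m R))
    (hk : Integrable k (ballMean m R)) (h : ∀ y, ‖w y - w' y‖ ≤ k y) :
    ‖ballAverage w R - ballAverage w' R‖ ≤ ballAverage k R := by
  rw [ballAverage, ballAverage, ← integral_sub hw hw']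
  exact (norm_integral_le_integral_norm _).trans
    (integral_mono (hw.sub hw').norm hk h)

/-- Averages of `T (u, f)` and `T (v, f)` are asymptotically as close as `u` and `v` are. -/
lemma eventually_norm_ballAverage_sub_le {p : ℝ≥0∞} [hp : Fact (1 ≤ p)] (T : F₁ →L[ℝ] F₂ →L[ℝ] F)
    (u v : Marcinkiewicz m p F₁) (f : Euc m →ᵇ F₂) {δ : ℝ} (hδ : ‖u - v‖ < δ) :
    ∀ᶠ R in atTop, ‖ballAverage (fun y => T (u.fn y) (f y)) R
      - ballAverage (fun y => T (v.fn y) (f y)) R‖ ≤ ‖T‖ * ‖f‖ * δ := by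
  have hlt : besSeminorm p (u - v).fn < ENNReal.ofReal δ := by
    rw [Marcinkiewicz.norm_def] at hδ
    exact (ENNReal.lt_ofReal_iff_toReal_lt (u - v).besSeminorm_lt_top.ne).2 hδ
  filter_upwards [eventually_lt_of_limsup_lt hlt, eventually_gt_atTop 0] with R h1 hR
  have := isProbabilityMeasure_ballMean (m := m) hR
  have hu := integrable_ballMean_of_memLp hp.out hR (u.memLp R)
  have hv := integrable_ballMean_of_memLp hp.out hR (v.memLp R)
  have huv := integrable_ballMean_of_memLp hp.out hR ((u - v).memLp R)
  refine (norm_ballAverage_sub_le (k := fun y => ‖T‖ * ‖f‖ * ‖(u - v).fn y‖)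
    (integrable_bilin T hu f) (integrable_bilin T hv f) (huv.norm.const_mul _) ?_).trans ?_
  · intro y
    rw [← _root_.sub_apply, ← map_sub]
    refine (T.le_opNorm₂ _ _).trans ?_
    rw [mul_right_comm]
    gcongr
    · exact f.norm_coe_le_norm y
    · exact le_rfl
  · rw [ballAverage, integral_const_mul]
    refine mul_le_mul_of_nonneg_left ?_ (by positivity)
    rw [integral_norm_eq_lintegral_enorm huv.1, ← eLpNorm_one_eq_lintegral_enorm]
    refine ENNReal.toReal_le_of_le_ofReal ?_
      ((eLpNorm_le_eLpNorm_of_exponent_le hp.out huv.1).trans h1.le)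
    exact ((norm_nonneg _).trans_lt hδ).le

/-- The mean value of a product does not depend on the representative of its first factor. -/
lemma meanValue_bilin_congr {p : ℝ≥0∞} [hp : Fact (1 ≤ p)] (T : F₁ →L[ℝ] F₂ →L[ℝ] F)
    (u v : Marcinkiewicz m p F₁) (f : Euc m →ᵇ F₂) (h : ‖u - v‖ = 0) :
    meanValue (fun y => T (u.fn y) (f y)) = meanValue (fun y => T (v.fn y) (f y)) := by
  have h0 : Tendsto (fun R => ballAverage (fun y => T (u.fn y) (f y)) R
      - ballAverage (fun y => T (v.fn y) (f y)) R) atTop (𝓝 0) := by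
    rw [Metric.tendsto_nhds]
    intro η hη
    have hc : 0 < ‖T‖ * ‖f‖ + 1 := by positivity
    filter_upwards [eventually_norm_ballAverage_sub_le T u v f
      (δ := η / (‖T‖ * ‖f‖ + 1)) (by rw [h]; positivity)] with R hR
    rw [dist_zero_right]
    refine hR.trans_lt ?_
    rw [mul_div_assoc', div_lt_iff₀ hc]
    nlinarith
  have key : ∀ x : F, Tendsto (ballAverage fun y => T (u.fn y) (f y)) atTop (𝓝 x) ↔
      Tendsto (ballAverage fun y => T (v.fn y) (f y)) atTop (𝓝 x) := fun x => by
    constructor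
    · intro hx
      simpa using hx.sub h0
    · intro hx
      simpa using hx.add h0
  unfold meanValue limUnder lim
  congr 1
  funext x
  exact propext (key x)

lemma tendsto_of_approx [CompleteSpace F] {w : Euc m → F}
    (h : ∀ η > 0, ∃ w' : Euc m → F, (∃ l, Tendsto (ballAverage w') atTop (𝓝 l)) ∧
      ∀ᶠ R in atTop, ‖ballAverage w R - ballAverage w' R‖ ≤ η) :
    ∃ l, Tendsto (ballAverage w) atTop (𝓝 l) := by
  rw [← cauchy_map_iff_exists_tendsto, Metric.cauchy_iff]
  refine ⟨inferInstance, fun η hη => ?_⟩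
  obtain ⟨w', ⟨l, hl⟩, hw⟩ := h (η / 4) (by positivity)
  have hl' := Metric.tendsto_nhds.1 hl (η / 4) (by positivity)
  refine ⟨ball l (η / 2), ?_, fun x hx y hy => ?_⟩
  · rw [mem_map]
    filter_upwards [hl', hw] with R h1 h2
    change ballAverage w R ∈ ball l (η / 2)
    rw [mem_ball]
    have := dist_triangle (ballAverage w R) (ballAverage w' R) l
    rw [← dist_eq_norm] at h2
    linarith
  · have := dist_triangle_right x y l
    rw [mem_ball] at hx hy
    linarith

/-- Ball averages of the elements of the algebra converge. -/
lemma exists_tendsto_ballAverage {A : Subalgebra ℝ (Euc m →ᵇ ℝ)} (hA : IsAlgebraWithMeanValue A)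
    {a : Euc m →ᵇ ℝ} (ha : a ∈ A) : ∃ l, Tendsto (ballAverage a) atTop (𝓝 l) := by
  obtain ⟨M, hM⟩ := hA.mean_value a ha
  have h1 := hM ((ball 0 1).indicator fun _ => (volume.real (ball (0 : Euc m) 1))⁻¹)
    ((integrable_indicator_iff measurableSet_ball).2 (integrableOn_const measure_ball_lt_top.ne))
  have h2 := h1.comp tendsto_inv_atTop_nhdsGT_zero
  refine ⟨_, h2.congr' ?_⟩
  filter_upwards [eventually_gt_atTop 0] with R hR
  have e : ∀ x : Euc m, a ((R⁻¹)⁻¹ • x) * (ball (0 : Euc m) 1).indicator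
      (fun _ => (volume.real (ball (0 : Euc m) 1))⁻¹) x
      = (ball (0 : Euc m) 1).indicator
        (fun x => a (R • x) * (volume.real (ball (0 : Euc m) 1))⁻¹) x := fun x => by
    by_cases hx : x ∈ ball (0 : Euc m) 1 <;> simp [hx]
  simp only [Function.comp_apply, e]
  rw [integral_indicator measurableSet_ball, integral_mul_const,
    Measure.setIntegral_comp_smul_of_pos _ _ _ hR, smul_unitBall_of_pos hR, ballAverage, ballMean,
    integral_smul_measure, ENNReal.toReal_inv, smul_eq_mul, smul_eq_mul,
    Measure.addHaar_ball_of_pos _ _ hR, ENNReal.toReal_mul, ENNReal.toReal_ofReal (by positivity),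
    Measure.real, mul_inv]
  ring

lemma exists_tendsto_ballAverage_span [CompleteSpace F] {A : Subalgebra ℝ (Euc m →ᵇ ℝ)}
    (hA : IsAlgebraWithMeanValue A) (T : F₁ →L[ℝ] F₂ →L[ℝ] F)
    {g : Euc m →ᵇ F₁} (hg : g ∈ Submodule.span ℝ {g : Euc m →ᵇ F₁ | ∃ a ∈ A, ∃ v : F₁,
      ∀ y, g y = a y • v})
    {f : Euc m →ᵇ F₂} (hf : f ∈ Submodule.span ℝ {g : Euc m →ᵇ F₂ | ∃ a ∈ A, ∃ v : F₂,
      ∀ y, g y = a y • v}) :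
    ∃ l, Tendsto (ballAverage fun y => T (g y) (f y)) atTop (𝓝 l) := by
  have hint : ∀ (g : Euc m →ᵇ F₁) (f : Euc m →ᵇ F₂) {R : ℝ}, 0 < R →
      Integrable (fun y => T (g y) (f y)) (ballMean m R) := fun g f R hR =>
    integrable_bilin T (integrable_ballMean_bcf g hR) f
  induction hg, hf using Submodule.span_induction₂ with
  | mem_mem g f hg hf =>
    obtain ⟨a, ha, v, hv⟩ := hg
    obtain ⟨b, hb, v', hv'⟩ := hf
    obtain ⟨l, hl⟩ := exists_tendsto_ballAverage hA (A.mul_mem ha hb)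
    refine ⟨l • T v v', (hl.smul_const (T v v')).congr fun R => ?_⟩
    rw [ballAverage, ballAverage, ← integral_smul_const]
    refine integral_congr_ae (Eventually.of_forall fun y => ?_)
    simp [hv, hv', smul_smul, mul_comm]
  | zero_left f hf =>
    refine ⟨0, tendsto_const_nhds.congr fun R => ?_⟩
    simp [ballAverage]
  | zero_right g hg =>
    refine ⟨0, tendsto_const_nhds.congr fun R => ?_⟩
    simp [ballAverage]
  | add_left g g' f _ _ _ h1 h2 =>
    obtain ⟨l, hl⟩ := h1
    obtain ⟨l', hl'⟩ := h2
    refine ⟨l + l', (hl.add hl').congr' ?_⟩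
    filter_upwards [eventually_gt_atTop 0] with R hR
    rw [ballAverage, ballAverage, ballAverage, ← integral_add (hint _ _ hR) (hint _ _ hR)]
    simp
  | add_right g f f' _ _ _ h1 h2 =>
    obtain ⟨l, hl⟩ := h1
    obtain ⟨l', hl'⟩ := h2
    refine ⟨l + l', (hl.add hl').congr' ?_⟩
    filter_upwards [eventually_gt_atTop 0] with R hR
    rw [ballAverage, ballAverage, ballAverage, ← integral_add (hint _ _ hR) (hint _ _ hR)]
    simp
  | smul_left c g f _ _ h =>
    obtain ⟨l, hl⟩ := h
    refine ⟨c • l, (hl.const_smul c).congr fun R => ?_⟩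
    rw [ballAverage, ballAverage, ← integral_smul]
    simp
  | smul_right c g f _ _ h =>
    obtain ⟨l, hl⟩ := h
    refine ⟨c • l, (hl.const_smul c).congr fun R => ?_⟩
    rw [ballAverage, ballAverage, ← integral_smul]
    simp

/-- The averages of the product of an element of the Besicovitch space and of an element of the
vector-valued algebra converge, so that the mean value of the product is a genuine limit. -/
theorem tendsto_ballAverage_bilin [CompleteSpace F] {A : Subalgebra ℝ (Euc m →ᵇ ℝ)}
    (hA : IsAlgebraWithMeanValue A) {p : ℝ≥0∞} [hp : Fact (1 ≤ p)] (T : F₁ →L[ℝ] F₂ →L[ℝ] F)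
    (u : besicovitchSubmodule A p F₁) (f : vecAlgebra A F₂) :
    Tendsto (ballAverage fun y => T (u.1.fn y) (f.1 y)) atTop
      (𝓝 (meanValue fun y => T (u.1.fn y) (f.1 y))) := by
  refine tendsto_nhds_limUnder ?_
  have hint : ∀ (g : Euc m →ᵇ F₁) (f : Euc m →ᵇ F₂) {R : ℝ}, 0 < R →
      Integrable (fun y => T (g y) (f y)) (ballMean m R) := fun g f R hR =>
    integrable_bilin T (integrable_ballMean_bcf g hR) f
  have hconst : ∀ (c : ℝ) {R : ℝ}, 0 < R → Integrable (fun _ => c) (ballMean m R) :=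
    fun c R hR => by
      have := isProbabilityMeasure_ballMean (m := m) hR
      exact integrable_const c
  have havg : ∀ (c : ℝ) {R : ℝ}, 0 < R → ballAverage (fun _ : Euc m => c) R = c :=
    fun c R hR => by
      have := isProbabilityMeasure_ballMean (m := m) hR
      simp [ballAverage]
  obtain ⟨f, hf⟩ := f
  have step1 : ∀ g ∈ Submodule.span ℝ {g : Euc m →ᵇ F₁ | ∃ a ∈ A, ∃ v : F₁,
      ∀ y, g y = a y • v}, ∃ l, Tendsto (ballAverage fun y => T (g y) (f y)) atTop (𝓝 l) := by
    intro g hg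
    refine tendsto_of_approx fun η hη => ?_
    have hc : 0 < ‖T‖ * ‖g‖ + 1 := by positivity
    obtain ⟨f', hf', hd⟩ := Metric.mem_closure_iff.1 hf (η / (‖T‖ * ‖g‖ + 1)) (by positivity)
    refine ⟨_, exists_tendsto_ballAverage_span hA T hg hf', ?_⟩
    filter_upwards [eventually_gt_atTop 0] with R hR
    refine (norm_ballAverage_sub_le (hint _ _ hR) (hint _ _ hR) (hconst η hR) ?_).trans
      (havg η hR).le
    intro y
    rw [← map_sub]
    calc ‖T (g y) (f y - f' y)‖ ≤ ‖T‖ * ‖g y‖ * ‖f y - f' y‖ := T.le_opNorm₂ _ _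
      _ ≤ (‖T‖ * ‖g‖) * (η / (‖T‖ * ‖g‖ + 1)) := by
          gcongr
          · exact g.norm_coe_le_norm y
          · rw [← dist_eq_norm]
            exact (BoundedContinuousFunction.dist_coe_le_dist y).trans hd.le
      _ ≤ η := by
          rw [mul_div_assoc', div_le_iff₀ hc]
          nlinarith
  have step2 : ∀ g ∈ vecAlgebra A F₁,
      ∃ l, Tendsto (ballAverage fun y => T (g y) (f y)) atTop (𝓝 l) := by
    intro g hg
    refine tendsto_of_approx fun η hη => ?_
    have hc : 0 < ‖T‖ * ‖f‖ + 1 := by positivity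
    obtain ⟨g', hg', hd⟩ := Metric.mem_closure_iff.1 hg (η / (‖T‖ * ‖f‖ + 1)) (by positivity)
    refine ⟨_, step1 g' hg', ?_⟩
    filter_upwards [eventually_gt_atTop 0] with R hR
    refine (norm_ballAverage_sub_le (hint _ _ hR) (hint _ _ hR) (hconst η hR) ?_).trans
      (havg η hR).le
    intro y
    rw [← _root_.sub_apply, ← map_sub]
    calc ‖T (g y - g' y) (f y)‖ ≤ ‖T‖ * ‖g y - g' y‖ * ‖f y‖ := T.le_opNorm₂ _ _
      _ ≤ ‖T‖ * (η / (‖T‖ * ‖f‖ + 1)) * ‖f‖ := by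
          gcongr
          · rw [← dist_eq_norm]
            exact (BoundedContinuousFunction.dist_coe_le_dist y).trans hd.le
          · exact f.norm_coe_le_norm y
      _ ≤ η := by
          rw [mul_right_comm, mul_div_assoc', div_le_iff₀ hc]
          nlinarith
  refine tendsto_of_approx fun η hη => ?_
  have hc : 0 < ‖T‖ * ‖f‖ + 1 := by positivity
  obtain ⟨_, ⟨g, hg, rfl⟩, hd⟩ :=
    Metric.mem_closure_iff.1 u.2 (η / (‖T‖ * ‖f‖ + 1)) (by positivity)
  refine ⟨_, step2 g hg, ?_⟩
  rw [dist_eq_norm] at hd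
  filter_upwards [eventually_norm_ballAverage_sub_le T u.1 (ofBCF g) f hd] with R hR
  refine hR.trans ?_
  rw [mul_div_assoc', div_le_iff₀ hc]
  nlinarith

end

/-! ### Thin domains and weak Σ-convergence -/

/-- The thin domain `G_ε = G₁ × ε G₂`. -/
def thinDomain {d₁ d₂ : ℕ} (G₁ : Set (Euc d₁)) (G₂ : Set (Euc d₂)) (ε : ℝ) :
    Set (Euc d₁ × Euc d₂) := G₁ ×ˢ (ε • G₂)

/-- Real `L^p` functions on a domain with Lebesgue measure. -/
abbrev LpOn {d : ℕ} (p : ℝ≥0∞) (G : Set (Euc d)) : Type :=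
  Lp ℝ p (volume.restrict G)

/-- The pointwise product `L^p(G) × L^q(G) → L^1(G)` for conjugate exponents. -/
def lpMul {d : ℕ} (p q : ℝ≥0∞) [Fact (1 ≤ p)] [Fact (1 ≤ q)] [p.HolderConjugate q]
    (G : Set (Euc d)) : LpOn p G →L[ℝ] LpOn q G →L[ℝ] LpOn 1 G :=
  (ContinuousLinearMap.mul ℝ ℝ).holderL (volume.restrict G) p q 1

/-- For `v ∈ 𝓑_A^p(ℝ^{d₁}; L^p(G₂))` and `f ∈ A(ℝ^{d₁}; L^q(G₂))`, the function
`ζ ↦ M(v(·, ζ) f(·, ζ))`, i.e. the mean value in `L^1(G₂)` of the product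
`y ↦ v(y, ·) f(y, ·)`; it does not depend on the representative of `v`. -/
def meanProduct {d₁ d₂ : ℕ} {A : Subalgebra ℝ (Euc d₁ →ᵇ ℝ)} {p q : ℝ≥0∞} [Fact (1 ≤ p)]
    [Fact (1 ≤ q)] [p.HolderConjugate q] {G₂ : Set (Euc d₂)}
    (v : Besicovitch A p (LpOn p G₂)) (f : vecAlgebra A (LpOn q G₂)) : LpOn 1 G₂ :=
  SeparationQuotient.lift
    (fun w : besicovitchSubmodule A p (LpOn p G₂) =>
      meanValue fun y => lpMul p q G₂ (w.1.fn y) (f.1 y))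
    (fun w w' h => meanValue_bilin_congr (lpMul p q G₂) w.1 w'.1 f.1 (by
      rw [Metric.inseparable_iff, Subtype.dist_eq, dist_eq_norm] at h
      exact h)) v

/-- Weak Σ-convergence along a sequence `ε_n` of positive numbers tending to zero of functions
`u_n ∈ L^p(G_{ε_n})` to `u₀ ∈ L^p(G₀; 𝓑_A^p(ℝ^{d₁}; L^p(G₂)))` (where `G₀ = G₁ × {0}` is identified
with `G₁`): for every `f ∈ L^q(G₀; A(ℝ^{d₁}; L^q(G₂)))`,
`ε^{-d₂} ∫_{G_ε} u_ε(x) f(x̄, x / ε) dx → ∫_{G₀} ∫_{G₂} M(u₀(x̄, ·, ζ) f(x̄, ·, ζ)) dζ dx̄`.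

The integral over `G_ε = G₁ × ε G₂` is written as an iterated integral in `x = (x̄, z)`: for almost
every `x̄` the function `f(x̄, x̄ / ε, ·)` is an element of `L^q(G₂)`, hence only a class, and the
iterated integral does not depend on how its representatives for the various `x̄` are chosen. -/
def WeakSigmaConverges {d₁ d₂ : ℕ} (A : Subalgebra ℝ (Euc d₁ →ᵇ ℝ)) (p q : ℝ≥0∞) [Fact (1 ≤ p)]
    [Fact (1 ≤ q)] [p.HolderConjugate q] (G₁ : Set (Euc d₁)) (G₂ : Set (Euc d₂)) (ε : ℕ → ℝ)
    (u : ∀ n, Lp ℝ p (volume.restrict (thinDomain G₁ G₂ (ε n))))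
    (u₀ : Lp (Besicovitch A p (LpOn p G₂)) p (volume.restrict G₁)) : Prop :=
  ∀ f : Lp (vecAlgebra A (LpOn q G₂)) q (volume.restrict G₁),
    Tendsto
      (fun n => (ε n ^ d₂)⁻¹ * ∫ x in G₁, ∫ z in ε n • G₂,
        u n (x, z) * ((f x).1 ((ε n)⁻¹ • x) : LpOn q G₂) ((ε n)⁻¹ • z))
      atTop
      (𝓝 (∫ x in G₁, ∫ ζ in G₂, meanProduct (u₀ x) (f x) ζ))

end ThinSigma

end

open ThinSigma

noncomputable section

namespace ThinSigma

/-! ### The duality map of the real line -/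

/-! After the change of variables z = εζ the functions w_n(x̄, ζ) = u_n(x̄, ε_n ζ) are bounded in
L^p(G₁ × G₂), and the left-hand sides become linear forms L_n on Z = L^q(G₁; A(L^q(G₂))), q = p',
bounded uniformly in n. For separable A a diagonal argument over a countable dense set would give
the subsequence. Here A is arbitrary, and a variational argument takes its place.

Let s be a simple function of (x̄, ζ) with values in A; such functions are dense in Z
(`range_simpleLp_dense`, `range_simpleEmb_dense`). Hölder gives |L_n s| ≤ C (∫∫ |s(x̄, x̄/ε_n,
ζ)|^q)^{1/q}. Since |s|^q is again A-valued, the right side tends to C (∫∫ M(|s|^q))^{1/q}. By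
Young's inequality L_n s is therefore eventually at most a constant plus half the energy Q(s) = q⁻¹
∫∫ M(|s|^q) (`eventually_sigmaForm_le`).

So L_n − Q is eventually bounded above at each point by a common constant, and countably many
choices produce one subsequence together with points x_k that almost maximize it in the limit
(`exists_subseq_almost_maximizers`). The energy is uniformly smooth, so at an almost maximizer the
derivative almost vanishes: along the subsequence L_n is close to J(x_k), where J is the derivative
of Q, with an error uniform over directions of bounded energy
(`exists_subseq_asymptotic_derivative`).

Hence the forms J(x_k) are Cauchy, uniformly on sets of bounded energy. Now J(x) is the pairing with
|x|^{q-1} sgn x, and the uniform monotonicity of this map turns Cauchy forms into a norm-Cauchy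
sequence in L^p(G₁; 𝓑_A^p(L^p(G₂))) (`cauchySeq_biBes_dualityMap`). That space is complete
(`completeSpace_besicovitch`); the limit is u₀, and density together with the uniform bound on the
L_n carries the convergence to all of Z (`exists_subseq_tendsto_of_energy`). -/

/-- The function `|a|^{r-1} sgn a`, the derivative of `|a|^r / r`. -/
def dualityMap (r a : ℝ) : ℝ := (max a 0) ^ (r - 1) - (max (-a) 0) ^ (r - 1)

lemma continuous_dualityMap {r : ℝ} (hr : 1 < r) : Continuous (dualityMap r) := by
  unfold dualityMap
  have h : ∀ x : ℝ, x ≠ 0 ∨ 0 ≤ r - 1 := fun _ => Or.inr (by linarith)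
  exact ((continuous_id.max continuous_const).rpow_const fun _ => h _).sub
    ((continuous_neg.max continuous_const).rpow_const fun _ => h _)

lemma dualityMap_of_nonneg {r a : ℝ} (hr : 1 < r) (ha : 0 ≤ a) : dualityMap r a = a ^ (r - 1) := by
  rw [dualityMap, max_eq_left ha, max_eq_right (by linarith), Real.zero_rpow (by linarith), sub_zero]

lemma dualityMap_neg (r a : ℝ) : dualityMap r (-a) = -dualityMap r a := by
  simp [dualityMap]

lemma abs_dualityMap {r : ℝ} (hr : 1 < r) (a : ℝ) : |dualityMap r a| = |a| ^ (r - 1) := by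
  rcases le_total 0 a with ha | ha
  · rw [dualityMap_of_nonneg hr ha, abs_of_nonneg ha, abs_of_nonneg (Real.rpow_nonneg ha _)]
  · have hn : 0 ≤ -a := by linarith
    rw [← neg_neg a, dualityMap_neg, abs_neg, abs_neg, dualityMap_of_nonneg hr hn,
      abs_of_nonneg hn, abs_of_nonneg (Real.rpow_nonneg hn _)]

lemma mul_rpow_sub_one {r a : ℝ} (hr : 1 < r) (ha : 0 ≤ a) : a ^ (r - 1) * a = a ^ r := by
  rcases ha.eq_or_lt with rfl | ha
  · rw [mul_zero, Real.zero_rpow (by linarith)]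
  · rw [Real.rpow_sub_one ha.ne', div_mul_cancel₀ _ ha.ne']

lemma dualityMap_mul_self {r : ℝ} (hr : 1 < r) (a : ℝ) : dualityMap r a * a = |a| ^ r := by
  rcases le_total 0 a with ha | ha
  · rw [dualityMap_of_nonneg hr ha, abs_of_nonneg ha, mul_rpow_sub_one hr ha]
  · have hn : 0 ≤ -a := by linarith
    have := mul_rpow_sub_one hr hn
    rw [← neg_neg a, dualityMap_neg, abs_neg, dualityMap_of_nonneg hr hn, abs_of_nonneg hn]
    linarith

lemma dualityMap_mul {r c : ℝ} (hc : 0 ≤ c) (a : ℝ) :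
    dualityMap r (c * a) = c ^ (r - 1) * dualityMap r a := by
  have h : ∀ a : ℝ, max (c * a) 0 = c * max a 0 := fun a => by
    rw [mul_max_of_nonneg _ _ hc, mul_zero]
  rw [dualityMap, dualityMap, h, ← mul_neg, h, Real.mul_rpow hc (le_max_right _ _),
    Real.mul_rpow hc (le_max_right _ _), mul_sub]

lemma strictMono_dualityMap {r : ℝ} (hr : 1 < r) : StrictMono (dualityMap r) := by
  have hpos : StrictMonoOn (dualityMap r) (Set.Ici 0) := fun a ha b hb hab => by
    rw [dualityMap_of_nonneg hr ha, dualityMap_of_nonneg hr hb]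
    exact Real.rpow_lt_rpow ha hab (by linarith)
  exact strictMono_of_odd_strictMonoOn_nonneg (dualityMap_neg r) hpos

/-- The graph of `|a|^r / r` lies above its tangents. -/
lemma dualityMap_mul_sub_le {r : ℝ} (hr : 1 < r) (a b : ℝ) :
    |a| ^ r / r + dualityMap r a * (b - a) ≤ |b| ^ r / r := by
  have hy := Real.young_inequality_of_nonneg (abs_nonneg b)
    (Real.rpow_nonneg (abs_nonneg a) (r - 1)) (Real.HolderConjugate.conjExponent hr)
  have e1 : (|a| ^ (r - 1)) ^ r.conjExponent = |a| ^ r := by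
    rw [← Real.rpow_mul (abs_nonneg a), Real.conjExponent, mul_div_cancel₀ _ (by linarith)]
  have e2 : |a| ^ r / r.conjExponent = |a| ^ r - |a| ^ r / r := by
    rw [Real.conjExponent]; field_simp
  have h1 : dualityMap r a * b ≤ |b| * |a| ^ (r - 1) := by
    rw [← abs_dualityMap hr, mul_comm |b|, ← abs_mul]
    exact le_abs_self _
  rw [e1, e2] at hy
  have := dualityMap_mul_self hr a
  linarith

/-- Uniform smoothness: the remainder of the first order expansion of `|a|^r / r`. -/
lemma exists_dualityMap_smooth {r : ℝ} (hr : 1 < r) {η : ℝ} (hη : 0 < η) :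
    ∃ t > 0, ∀ a b : ℝ,
      |a + t * b| ^ r / r ≤ |a| ^ r / r + t * (dualityMap r a * b) + η * t * (|a| ^ r + |b| ^ r) := by
  -- After division by max(|a|, |b|), and with t ≤ 1, both a and a + tb lie in [-2, 2]; homogeneity
  -- then lets one modulus of continuity serve all a and b.
  have hu := isCompact_Icc.uniformContinuousOn_of_continuous
    ((continuous_dualityMap hr).continuousOn (s := Set.Icc (-2) 2))
  obtain ⟨δ, hδ, hu⟩ := Metric.uniformContinuousOn_iff_le.1 hu η hη
  have ht : 0 < min δ 1 := lt_min hδ one_pos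
  refine ⟨min δ 1, ht, fun a b => ?_⟩
  set t := min δ 1
  have ht1 : t ≤ 1 := min_le_right _ _
  have key : (dualityMap r (a + t * b) - dualityMap r a) * b ≤ η * (|a| ^ r + |b| ^ r) := by
    set m := max |a| |b|
    have ham : |a| ≤ m := le_max_left _ _
    have hbm : |b| ≤ m := le_max_right _ _
    have hm0 : 0 ≤ m := (abs_nonneg a).trans ham
    have hsum : m ^ r ≤ |a| ^ r + |b| ^ r := by
      rcases max_choice |a| |b| with h | h
      · exact (by rw [← h] : m ^ r = |a| ^ r).le.trans
          (le_add_of_nonneg_right (Real.rpow_nonneg (abs_nonneg _) _))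
      · exact (by rw [← h] : m ^ r = |b| ^ r).le.trans
          (le_add_of_nonneg_left (Real.rpow_nonneg (abs_nonneg _) _))
    rcases hm0.eq_or_lt with h0 | hm
    · have hb : b = 0 := abs_eq_zero.1 (le_antisymm (h0 ▸ hbm) (abs_nonneg _))
      rw [hb, mul_zero]
      positivity
    have ha1 : |a / m| ≤ 1 := by rw [abs_div, abs_of_pos hm]; exact (div_le_one hm).2 ham
    have hb1 : |b / m| ≤ 1 := by rw [abs_div, abs_of_pos hm]; exact (div_le_one hm).2 hbm
    obtain ⟨ha2, ha3⟩ := abs_le.1 ha1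
    have htb : |t * (b / m)| ≤ t := by
      rw [abs_mul, abs_of_pos ht]; exact mul_le_of_le_one_right ht.le hb1
    obtain ⟨hb2, hb3⟩ := abs_le.1 htb
    have hd := hu (a / m + t * (b / m)) ⟨by linarith, by linarith⟩ (a / m)
      ⟨by linarith, by linarith⟩ (by
        rw [Real.dist_eq, add_sub_cancel_left]; exact htb.trans (min_le_left _ _))
    rw [Real.dist_eq] at hd
    have e1 : dualityMap r (a + t * b) = m ^ (r - 1) * dualityMap r (a / m + t * (b / m)) := by
      rw [← dualityMap_mul hm0]; congr 1; field_simp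
    have e2 : dualityMap r a = m ^ (r - 1) * dualityMap r (a / m) := by
      rw [← dualityMap_mul hm0]; congr 1; field_simp
    calc (dualityMap r (a + t * b) - dualityMap r a) * b
        ≤ |(dualityMap r (a + t * b) - dualityMap r a) * b| := le_abs_self _
      _ = m ^ (r - 1) * |dualityMap r (a / m + t * (b / m)) - dualityMap r (a / m)| * |b| := by
          rw [e1, e2, ← mul_sub, abs_mul, abs_mul, abs_of_nonneg (Real.rpow_nonneg hm0 _)]
      _ ≤ m ^ (r - 1) * η * m := by gcongr
      _ = η * m ^ r := by rw [← mul_rpow_sub_one hr hm0]; ring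
      _ ≤ η * (|a| ^ r + |b| ^ r) := by gcongr
  -- The tangent is taken at the moved point a + tb and evaluated at a: this bounds the increment
  -- from above by t times the derivative at a + tb, and `key` moves that derivative back to a.
  have h := dualityMap_mul_sub_le hr (a + t * b) a
  nlinarith [mul_le_mul_of_nonneg_left key ht.le]

/-- Uniform strict monotonicity of the duality map. -/
lemma exists_dualityMap_sub_le {r s : ℝ} (h : r.HolderConjugate s) {η : ℝ} (hη : 0 < η) :
    ∃ K ≥ 0, ∀ a b : ℝ, |dualityMap r a - dualityMap r b| ^ s ≤
      η * (|a| ^ r + |b| ^ r) + K * ((dualityMap r a - dualityMap r b) * (a - b)) := by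
  have hr := h.lt
  have hs := h.symm.lt
  have hj := continuous_dualityMap hr
  have hc1 : Continuous fun x : ℝ × ℝ => |dualityMap r x.1 - dualityMap r x.2| ^ s :=
    ((hj.comp continuous_fst).sub (hj.comp continuous_snd)).abs.rpow_const
      fun _ => Or.inr (by linarith)
  have hc2 : Continuous fun x : ℝ × ℝ => η * (|x.1| ^ r + |x.2| ^ r) :=
    continuous_const.mul ((continuous_fst.abs.rpow_const fun _ => Or.inr (by linarith)).add
      (continuous_snd.abs.rpow_const fun _ => Or.inr (by linarith)))
  have hc3 : Continuous fun x : ℝ × ℝ => (dualityMap r x.1 - dualityMap r x.2) * (x.1 - x.2) :=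
    ((hj.comp continuous_fst).sub (hj.comp continuous_snd)).mul (continuous_fst.sub continuous_snd)
  have hmono : ∀ a b : ℝ, 0 ≤ (dualityMap r a - dualityMap r b) * (a - b) := fun a b => by
    rcases le_total a b with hab | hab
    · exact mul_nonneg_of_nonpos_of_nonpos
        (sub_nonpos.2 ((strictMono_dualityMap hr).monotone hab)) (sub_nonpos.2 hab)
    · exact mul_nonneg
        (sub_nonneg.2 ((strictMono_dualityMap hr).monotone hab)) (sub_nonneg.2 hab)
  have hpos : ∀ a b : ℝ, a ≠ b → 0 < (dualityMap r a - dualityMap r b) * (a - b) := fun a b hab =>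
    lt_of_le_of_ne (hmono a b) (mul_ne_zero
      (sub_ne_zero.2 ((strictMono_dualityMap hr).injective.ne hab)) (sub_ne_zero.2 hab)).symm
  -- All terms are homogeneous of degree r, since (r - 1)s = r, so the unit sphere suffices.
  have sphere : ∃ K ≥ 0, ∀ x ∈ sphere (0 : ℝ × ℝ) 1,
      |dualityMap r x.1 - dualityMap r x.2| ^ s ≤
      η * (|x.1| ^ r + |x.2| ^ r) + K * ((dualityMap r x.1 - dualityMap r x.2) * (x.1 - x.2)) := by
    -- Only the points where the η-term alone does not suffice matter. They form a compact set that
    -- misses the diagonal, where the left side is 0 but the η-term is positive; there the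
    -- monotonicity term is positive, and K bounds a continuous quotient.
    set S := sphere (0 : ℝ × ℝ) 1 ∩
      {x | η * (|x.1| ^ r + |x.2| ^ r) ≤ |dualityMap r x.1 - dualityMap r x.2| ^ s}
    have hS : IsCompact S := (isCompact_sphere _ _).inter_right (isClosed_le hc2 hc1)
    have hSpos : ∀ x ∈ S, 0 < (dualityMap r x.1 - dualityMap r x.2) * (x.1 - x.2) := by
      rintro ⟨a, b⟩ ⟨hx, hx'⟩
      refine hpos a b ?_
      rintro rfl
      have ha : a ≠ 0 := by
        rintro rfl
        simp at hx
      have : 0 < |a| ^ r := Real.rpow_pos_of_pos (abs_pos.2 ha) _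
      simp only [Set.mem_ofPred_eq, sub_self, abs_zero] at hx'
      rw [Real.zero_rpow (by linarith)] at hx'
      nlinarith
    obtain ⟨K, hK⟩ := (hS.bddAbove_image (f := fun x : ℝ × ℝ =>
      |dualityMap r x.1 - dualityMap r x.2| ^ s /
        ((dualityMap r x.1 - dualityMap r x.2) * (x.1 - x.2)))
      (hc1.continuousOn.div hc3.continuousOn fun x hx => (hSpos x hx).ne'))
    refine ⟨max K 0, le_max_right _ _, fun x hx => ?_⟩
    have hη' : 0 ≤ η * (|x.1| ^ r + |x.2| ^ r) := by positivity
    by_cases hxS : x ∈ S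
    · have h1 := hK ⟨x, hxS, rfl⟩
      have h2 := (div_le_iff₀ (hSpos x hxS)).1 h1
      have h3 := mul_le_mul_of_nonneg_right (le_max_left K 0) (hSpos x hxS).le
      linarith
    · have h1 : |dualityMap r x.1 - dualityMap r x.2| ^ s ≤ η * (|x.1| ^ r + |x.2| ^ r) := by
        by_contra hcon
        exact hxS ⟨hx, (not_le.1 hcon).le⟩
      have := mul_nonneg (le_max_right K 0) (hmono x.1 x.2)
      linarith
  obtain ⟨K, hK0, hK⟩ := sphere
  refine ⟨K, hK0, fun a b => ?_⟩
  set m := ‖(a, b)‖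
  rcases (norm_nonneg (a, b)).eq_or_lt with h0 | hm
  · have : (a, b) = 0 := norm_eq_zero.1 h0.symm
    obtain ⟨rfl, rfl⟩ := Prod.mk_eq_zero.1 this
    simp [Real.zero_rpow (show r ≠ 0 by linarith), Real.zero_rpow (show s ≠ 0 by linarith)]
  · have hm' : 0 < m := hm
    have h1 := hK (a / m, b / m) (by
      rw [mem_sphere_zero_iff_norm]
      have : (a / m, b / m) = m⁻¹ • (a, b) := by
        simp [div_eq_inv_mul]
      rw [this, norm_smul, norm_inv, norm_norm, inv_mul_cancel₀ hm.ne'])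
    have ea : a = m * (a / m) := by field_simp
    have eb : b = m * (b / m) := by field_simp
    set a' := a / m
    set b' := b / m
    have hmr : 0 < m ^ r := Real.rpow_pos_of_pos hm' _
    have e1 : |dualityMap r a - dualityMap r b| ^ s
        = m ^ r * |dualityMap r a' - dualityMap r b'| ^ s := by
      rw [ea, eb, dualityMap_mul hm'.le, dualityMap_mul hm'.le, ← mul_sub, abs_mul,
        Real.mul_rpow (abs_nonneg _) (abs_nonneg _), abs_of_nonneg (Real.rpow_nonneg hm'.le _),
        ← Real.rpow_mul hm'.le, h.sub_one_mul_conj]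
    have e2 : |a| ^ r + |b| ^ r = m ^ r * (|a'| ^ r + |b'| ^ r) := by
      rw [ea, eb, abs_mul, abs_mul, Real.mul_rpow (abs_nonneg _) (abs_nonneg _),
        Real.mul_rpow (abs_nonneg _) (abs_nonneg _), abs_of_pos hm', mul_add]
    have e3 : (dualityMap r a - dualityMap r b) * (a - b)
        = m ^ r * ((dualityMap r a' - dualityMap r b') * (a' - b')) := by
      rw [ea, eb, dualityMap_mul hm'.le, dualityMap_mul hm'.le, ← mul_rpow_sub_one hr hm'.le]
      ring
    rw [e1, e2, e3]
    calc _ ≤ m ^ r * _ := mul_le_mul_of_nonneg_left h1 hmr.le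
      _ = _ := by ring

/-! ### Selection of a subsequence -/

/-- Given functions `H n` on a set `V` which are eventually bounded above at each point by a common
constant, there are a subsequence, points `x k` and levels `σ k` which are, in the limit, upper
bounds of the subsequence, attained at `x k` up to `1 / (k + 1)`. -/
theorem exists_subseq_almost_maximizers {V : Type*} (H : ℕ → V → ℝ) (B : ℝ)
    (hB : ∀ y, ∀ᶠ n in atTop, H n y ≤ B) (y₀ : V) (h0 : ∀ n, 0 ≤ H n y₀) :
    ∃ ψ : ℕ → ℕ, StrictMono ψ ∧ ∃ x : ℕ → V, ∃ σ : ℕ → ℝ, ∀ k,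
      (∀ y, ∀ᶠ n in atTop, H (ψ n) y ≤ σ k) ∧
        ∀ᶠ n in atTop, σ k - 1 / (k + 1) < H (ψ n) (x k) := by
  have step : ∀ (M : {M : Set ℕ // M.Infinite}) (k : ℕ), ∃ (σ : ℝ) (x : V)
      (M' : {M : Set ℕ // M.Infinite}), M'.1 ⊆ M.1 ∧
      (∀ y, ∀ᶠ n in atTop, n ∈ M.1 → H n y ≤ σ) ∧ ∀ n ∈ M'.1, σ - 1 / (k + 1) < H n x := by
    rintro ⟨M, hM⟩ k
    -- The threshold in n may depend on y, so `sInf S` plays the role of an asymptotic supremum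
    -- along M.
    set S := {σ : ℝ | ∀ y, ∀ᶠ n in atTop, n ∈ M → H n y ≤ σ}
    have hS : B ∈ S := fun y => (hB y).mono fun n hn _ => hn
    have hS0 : ∀ σ ∈ S, 0 ≤ σ := fun σ hσ => by
      obtain ⟨n, hn, hn'⟩ := ((Nat.frequently_atTop_iff_infinite.2 hM).and_eventually (hσ y₀)).exists
      exact (h0 n).trans (hn' hn)
    have hk : (0 : ℝ) < 1 / (k + 1) := Nat.one_div_pos_of_nat
    -- A level of S within 1/(k+1) of the infimum: lowering it by that amount leaves S, so some
    -- point exceeds the lowered level for infinitely many n in M. Those n form the next index set.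
    obtain ⟨σ, hσ, hσ'⟩ := exists_lt_of_csInf_lt ⟨B, hS⟩ (lt_add_of_pos_right (sInf S) hk)
    have hnot : σ - 1 / (k + 1) ∉ S := fun hmem => by
      have := csInf_le ⟨0, hS0⟩ hmem
      linarith
    have hnot' : ∃ x, ∃ᶠ n in atTop, n ∈ M ∧ σ - 1 / (k + 1) < H n x := by
      by_contra! hcon
      exact hnot hcon
    obtain ⟨x, hx⟩ := hnot'
    exact ⟨σ, x, ⟨_, Nat.frequently_atTop_iff_infinite.1 hx⟩, fun n hn => hn.1, hσ, fun n hn => hn.2⟩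
  choose σ x M' hM' hσ hx using step
  let N : ℕ → {M : Set ℕ // M.Infinite} := fun k =>
    Nat.rec ⟨Set.univ, Set.infinite_univ⟩ (fun k M => M' M k) k
  have hN : ∀ k, N (k + 1) = M' (N k) k := fun k => rfl
  have hanti : Antitone fun k => (N k).1 := antitone_nat_of_succ_le fun k => by
    rw [hN]; exact hM' _ _
  -- Diagonal extraction: the k-th index lies in the k-th set, so ψ is eventually inside each of the
  -- nested sets. Upper bounds survive this passage, and so does the strict inequality at each `x
  -- k`.
  obtain ⟨ψ, hψ, hψN⟩ := extraction_forall_of_frequently fun k =>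
    Nat.frequently_atTop_iff_infinite.2 (N k).2
  have hmem : ∀ k, ∀ᶠ n in atTop, ψ n ∈ (N k).1 := fun k => by
    filter_upwards [eventually_ge_atTop k] with n hn using hanti hn (hψN n)
  refine ⟨ψ, hψ, fun k => x (N k) k, fun k => σ (N k) k, fun k => ⟨fun y => ?_, ?_⟩⟩
  · filter_upwards [hmem k, hψ.tendsto_atTop.eventually (hσ (N k) k y)] with n h1 h2 using h2 h1
  · filter_upwards [hmem (k + 1)] with n hn
    exact hx (N k) k _ (by rw [← hN]; exact hn)

/-- Let `L n` be linear forms which are asymptotically dominated by a smooth functional `Q`, whose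
derivative is `J`. Along a subsequence, the forms `L n` are asymptotically close to `J (x k)`, with
`Q (x k)` bounded, uniformly on the sets where `Q` is bounded. The vector space need not be
separable. -/
theorem exists_subseq_asymptotic_derivative {V : Type*} [AddCommGroup V] [Module ℝ V]
    (L : ℕ → V →ₗ[ℝ] ℝ) (Q : V → ℝ) (J : V → V →ₗ[ℝ] ℝ) (hQ0 : Q 0 = 0) (hQneg : ∀ x, Q (-x) = Q x)
    (hQ : ∀ x, 0 ≤ Q x)
    (hsmooth : ∀ η > 0, ∃ t > 0, ∀ x y, Q (x + t • y) ≤ Q x + t * J x y + η * t * (Q x + Q y))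
    (B : ℝ) (hL : ∀ x, ∀ᶠ n in atTop, L n x ≤ B + Q x / 2) :
    ∃ ψ : ℕ → ℕ, StrictMono ψ ∧ ∃ x : ℕ → V, (∃ R, ∀ k, Q (x k) ≤ R) ∧
      ∀ R, ∀ η > 0, ∀ᶠ k in atTop, ∀ y, Q y ≤ R →
        ∀ᶠ n in atTop, |L (ψ n) y - J (x k) y| ≤ η := by
  obtain ⟨ψ, hψ, x, σ, h⟩ := exists_subseq_almost_maximizers (fun n x => L n x - Q x) B
    (fun y => (hL y).mono fun n hn => by linarith [hQ y]) 0 (fun n => by simp [hQ0])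
  have hσ : ∀ k, 0 ≤ σ k := fun k => by
    obtain ⟨n, hn⟩ := ((h k).1 0).exists
    simpa [hQ0] using hn
  -- The chain 0 ≤ σ k < L(x k) − Q(x k) + 1/(k+1) ≤ B − Q(x k)/2 + 1 bounds the energy of the
  -- almost maximizers; the factor 1/2 in `hL` is what leaves this room.
  have hQx : ∀ k, Q (x k) ≤ 2 * (B + 1) := fun k => by
    obtain ⟨n, h1, h2⟩ := ((h k).2.and (hψ.tendsto_atTop.eventually (hL (x k)))).exists
    have h3 : 1 / ((k : ℝ) + 1) ≤ 1 := by
      rw [div_le_one (by positivity)]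
      linarith [k.cast_nonneg (α := ℝ)]
    have := hσ k
    linarith
  refine ⟨ψ, hψ, x, ⟨_, hQx⟩, fun R η hη => ?_⟩
  set R' := 2 * (B + 1) + max R 0
  have hR' : 0 ≤ R' := add_nonneg ((hQ _).trans (hQx 0)) (le_max_right _ _)
  -- The step t is fixed before k: the smoothness remainder is then at most tη/2, and for large k
  -- the maximization defect 1/(k+1) is below tη/2 as well. Dividing by t leaves η.
  obtain ⟨t, ht, hsm⟩ := hsmooth (η / (2 * (R' + 1))) (by positivity)
  have hlim : ∀ᶠ k : ℕ in atTop, 1 / ((k : ℝ) + 1) < t * η / 2 :=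
    tendsto_one_div_add_atTop_nhds_zero_nat.eventually_lt_const (by positivity)
  filter_upwards [hlim] with k hk y hy
  have one : ∀ y, Q y ≤ R → ∀ᶠ n in atTop, L (ψ n) y - J (x k) y ≤ η := by
    intro y hy
    -- The competitor `x k + t • y` cannot exceed the level that `x k` almost attains.
    filter_upwards [(h k).2, (h k).1 (x k + t • y)] with n h1 h2
    rw [map_add, map_smul, smul_eq_mul] at h2
    have h3 := hsm (x k) y
    have h4 : Q (x k) + Q y ≤ R' := add_le_add (hQx k) (hy.trans (le_max_left _ _))
    have h5 : η / (2 * (R' + 1)) * t * (Q (x k) + Q y) ≤ t * η / 2 := by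
      calc _ ≤ η / (2 * (R' + 1)) * t * (R' + 1) :=
            mul_le_mul_of_nonneg_left (by linarith) (by positivity)
        _ = _ := by field_simp
    have h6 : t * (L (ψ n) y - J (x k) y) ≤ t * η := by linarith
    exact le_of_mul_le_mul_left h6 ht
  filter_upwards [one y hy, one (-y) (by rwa [hQneg])] with n h1 h2
  rw [map_neg, map_neg] at h2
  exact abs_le.2 ⟨by linarith, by linarith⟩

/-! ### Completeness of the Marcinkiewicz and Besicovitch spaces -/

lemma tendsto_volume_ball_atTop {m : ℕ} (hm : 1 ≤ m) :
    Tendsto (fun R : ℝ => volume (ball (0 : Euc m) R)) atTop (𝓝 ∞) := by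
  have h1 : Tendsto (fun R : ℝ => ENNReal.ofReal (R ^ m) * volume (ball (0 : Euc m) 1)) atTop
      (𝓝 (∞ * volume (ball (0 : Euc m) 1))) := by
    refine ENNReal.Tendsto.mul_const ?_ (Or.inl ENNReal.top_ne_zero)
    exact ENNReal.tendsto_ofReal_nhds_top.2 (tendsto_pow_atTop (by omega))
  rw [ENNReal.top_mul (measure_ball_pos _ _ one_pos).ne'] at h1
  refine h1.congr' ?_
  filter_upwards [eventually_gt_atTop 0] with R hR
  rw [Measure.addHaar_ball_of_pos _ _ hR, finrank_euclideanSpace_fin]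

/-- Averages of a locally `p`-integrable function with bounded support vanish at infinity. -/
lemma tendsto_eLpNorm_indicator_ballMean {m : ℕ} (hm : 1 ≤ m) {F : Type*} [NormedAddCommGroup F]
    {p : ℝ≥0∞} (hp : 1 ≤ p) (hp' : p ≠ ∞) {w : Euc m → F} {ρ : ℝ}
    (hw : MemLp w p (volume.restrict (ball 0 ρ))) :
    Tendsto (fun R => eLpNorm ((ball (0 : Euc m) ρ).indicator w) p (ballMean m R)) atTop (𝓝 0) := by
  have hp0 : p ≠ 0 := (zero_lt_one.trans_le hp).ne'
  have hpos : 0 < (1 / p).toReal :=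
    ENNReal.toReal_pos (by simpa using hp') (by simpa using hp0)
  have h1 : Tendsto (fun R : ℝ => ((volume (ball (0 : Euc m) R))⁻¹) ^ (1 / p).toReal *
      eLpNorm w p (volume.restrict (ball 0 ρ))) atTop
      (𝓝 (0 * eLpNorm w p (volume.restrict (ball 0 ρ)))) := by
    refine ENNReal.Tendsto.mul_const ?_ (Or.inr hw.eLpNorm_ne_top)
    have h2 := (tendsto_volume_ball_atTop hm).inv
    rw [ENNReal.inv_top] at h2
    have h3 := (ENNReal.continuous_rpow_const (y := (1 / p).toReal)).tendsto 0
    rw [ENNReal.zero_rpow_of_pos hpos] at h3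
    exact h3.comp h2
  rw [zero_mul] at h1
  refine tendsto_of_tendsto_of_tendsto_of_le_of_le tendsto_const_nhds h1 (fun _ => zero_le)
    fun R => ?_
  rw [ballMean, eLpNorm_smul_measure_of_ne_top (by simpa using hp'), smul_eq_mul]
  gcongr
  rw [eLpNorm_indicator_eq_eLpNorm_restrict measurableSet_ball]
  exact eLpNorm_mono_measure _ (Measure.restrict_mono_measure Measure.restrict_le_self _)

/-- The seminorm ignores what happens in a bounded region. Each increment of a rapidly Cauchy
sequence is cut off inside the radius beyond which its averages are at most 2^{-j}. The remaining
tails add up to a locally finite sum, and the discarded pieces have bounded support, hence seminorm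
zero. Completeness of F plays no role. -/
theorem completeSpace_marcinkiewicz {m : ℕ} (hm : 1 ≤ m) {p : ℝ≥0∞} [hp : Fact (1 ≤ p)]
    (hp' : p ≠ ∞) {F : Type*} [NormedAddCommGroup F] [NormedSpace ℝ F] :
    CompleteSpace (Marcinkiewicz m p F) := by
  refine Metric.complete_of_convergent_controlled_sequences (fun n => (1 / 2) ^ n)
    (fun n => by positivity) fun u hu => ?_
  set d : ℕ → Euc m → F := fun j => (u (j + 1)).fn - (u j).fn
  have hd : ∀ j R, MemLp (d j) p (volume.restrict (ball 0 R)) := fun j R =>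
    ((u (j + 1)).memLp R).sub ((u j).memLp R)
  -- Besides controlling the averages, the radius is at least j, which makes the sum of the tails
  -- locally finite.
  have hτ : ∀ j : ℕ, ∃ τ : ℝ, j ≤ τ ∧ ∀ R, τ ≤ R →
      eLpNorm (d j) p (ballMean m R) ≤ ENNReal.ofReal ((1 / 2) ^ j) := fun j => by
    have h1 := hu j (j + 1) j (Nat.le_succ j) le_rfl
    rw [dist_eq_norm, Marcinkiewicz.norm_def] at h1
    have h2 := (ENNReal.lt_ofReal_iff_toReal_lt (u (j + 1) - u j).besSeminorm_lt_top.ne).2 h1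
    obtain ⟨τ, hτ⟩ := eventually_atTop.1 (eventually_lt_of_limsup_lt h2)
    exact ⟨max j τ, le_max_left _ _, fun R hR => (hτ R ((le_max_right _ _).trans hR)).le⟩
  choose τ hjτ hτ using hτ
  set c : ℕ → Euc m → F := fun j => (ball 0 (τ j))ᶜ.indicator (d j)
  have hc : ∀ j R, MemLp (c j) p (volume.restrict (ball 0 R)) := fun j R =>
    (hd j R).indicator measurableSet_ball.compl
  have hind : ∀ j, ∀ y ∈ ball (0 : Euc m) (τ j), c j y = 0 := fun j y hy =>
    Set.indicator_of_notMem (Set.notMem_compl_iff.2 hy) _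
  have hc0 : ∀ (j : ℕ) y, ‖y‖ < j → c j y = 0 := fun j y hy =>
    hind j y (mem_ball_zero_iff.2 (hy.trans_le (hjτ j)))
  set v : Euc m → F := fun y => (u 0).fn y + ∑ j ∈ Finset.range (⌊‖y‖⌋₊ + 1), c j y
  have hv : ∀ (R : ℝ) (N : ℕ), R ≤ N → ∀ y ∈ ball (0 : Euc m) R,
      v y = ((u 0).fn + ∑ j ∈ Finset.range N, c j) y := by
    intro R N hN y hy
    rw [mem_ball_zero_iff] at hy
    simp only [v, Pi.add_apply, Finset.sum_apply]
    congr 1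
    refine Finset.sum_subset (Finset.range_mono ?_) fun j _ hj => hc0 j y ?_
    · exact Nat.succ_le_of_lt ((Nat.floor_lt (norm_nonneg y)).2 (hy.trans_le hN))
    · rw [Finset.mem_range, not_lt] at hj
      exact (Nat.lt_floor_add_one ‖y‖).trans_le (by exact_mod_cast hj)
  have hvae : ∀ (R : ℝ) (N : ℕ), R ≤ N → v =ᵐ[volume.restrict (ball 0 R)]
      (u 0).fn + ∑ j ∈ Finset.range N, c j := fun R N hN => by
    filter_upwards [ae_restrict_mem measurableSet_ball] with y hy using hv R N hN y hy
  have hvLp : ∀ R, MemLp v p (volume.restrict (ball 0 R)) := fun R => by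
    obtain ⟨N, hN⟩ := exists_nat_ge R
    exact (((u 0).memLp R).add (memLp_finsetSum' _ fun j _ => hc j R)).ae_eq (hvae R N hN).symm
  have hun : ∀ n, (u n).fn = (u 0).fn + ∑ j ∈ Finset.range n, d j := fun n => by
    have := Finset.sum_range_sub (fun j => (u j).fn) n
    rw [show ∑ j ∈ Finset.range n, d j = _ from this, add_sub_cancel]
  have hest : ∀ n, besSeminorm p (v - (u n).fn) ≤ ENNReal.ofReal (2 * (1 / 2) ^ n) := by
    intro n
    set e : ℕ → Euc m → F := fun j => (ball 0 (τ j)).indicator (d j)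
    have heLp : ∀ j R, MemLp (e j) p (volume.restrict (ball 0 R)) := fun j R =>
      (hd j R).indicator measurableSet_ball
    have he : ∀ j, d j - c j = e j := fun j => by
      simp only [c, e]
      rw [Set.indicator_compl]
      abel
    have hsmall : Tendsto (fun R => ∑ j ∈ Finset.range n, eLpNorm (e j) p (ballMean m R)) atTop
        (𝓝 (∑ j ∈ Finset.range n, 0)) :=
      tendsto_finsetSum _ fun j _ => tendsto_eLpNorm_indicator_ballMean hm hp.out hp' (hd j _)
    rw [Finset.sum_const_zero] at hsmall
    refine ENNReal.le_of_forall_pos_le_add fun δ hδ _ => limsup_le_of_le (by isBoundedDefault) ?_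
    filter_upwards [hsmall.eventually_lt_const (ENNReal.coe_pos.2 hδ), eventually_gt_atTop 0]
      with R hR hR0
    obtain ⟨N', hN'⟩ := exists_nat_ge R
    set N := max n N'
    have hnN : n ≤ N := le_max_left n N'
    have hN : R ≤ N := hN'.trans (by exact_mod_cast le_max_right n N')
    have hac : ballMean m R ≪ volume.restrict (ball 0 R) := Measure.smul_absolutelyContinuous
    have hE : v - (u n).fn =ᵐ[ballMean m R]
        ∑ j ∈ Finset.Ico n N, c j - ∑ j ∈ Finset.range n, e j := by
      have h1 : (u 0).fn + ∑ j ∈ Finset.range N, c j - (u n).fn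
          = ∑ j ∈ Finset.Ico n N, c j - ∑ j ∈ Finset.range n, e j := by
        have h2 : ∑ j ∈ Finset.range n, e j
            = ∑ j ∈ Finset.range n, d j - ∑ j ∈ Finset.range n, c j := by
          rw [← Finset.sum_sub_distrib]
          exact Finset.sum_congr rfl fun j _ => (he j).symm
        rw [hun n, Finset.sum_Ico_eq_sub c hnN, h2]
        abel
      filter_upwards [hac.ae_le (hvae R N hN)] with y hy
      rw [← h1, Pi.sub_apply, hy, Pi.sub_apply]
    have hcm : ∀ j, AEStronglyMeasurable (c j) (ballMean m R) := fun j =>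
      (memLp_ballMean hR0 (hc j R)).1
    have hem : ∀ j, AEStronglyMeasurable (e j) (ballMean m R) := fun j =>
      (memLp_ballMean hR0 (heLp j R)).1
    -- The bound holds for every R > 0, not only for large R: while R ≤ τ j the cut-off increment
    -- vanishes on the whole ball. This is what allows summation over a range of j that grows with
    -- R.
    have hcj : ∀ j, eLpNorm (c j) p (ballMean m R) ≤ ENNReal.ofReal ((1 / 2) ^ j) := fun j => by
      rcases le_total (τ j) R with h | h
      · exact (eLpNorm_indicator_le _).trans (hτ j R h)
      · have : c j =ᵐ[ballMean m R] 0 := by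
          refine hac.ae_le ?_
          filter_upwards [ae_restrict_mem measurableSet_ball] with y hy
          exact hind j y (ball_subset_ball h hy)
        rw [eLpNorm_congr_ae this, eLpNorm_zero]
        exact zero_le
    rw [eLpNorm_congr_ae hE, add_comm]
    refine (eLpNorm_sub_le (Finset.aestronglyMeasurable_sum _ fun j _ => hcm j)
      (Finset.aestronglyMeasurable_sum _ fun j _ => hem j) hp.out).trans ?_
    rw [add_comm]
    refine add_le_add ((eLpNorm_sum_le (fun j _ => hem j) hp.out).trans hR.le)
      ((eLpNorm_sum_le (fun j _ => hcm j) hp.out).trans ?_)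
    refine (Finset.sum_le_sum fun j _ => hcj j).trans ?_
    rw [← ENNReal.ofReal_sum_of_nonneg fun _ _ => by positivity]
    refine ENNReal.ofReal_le_ofReal ?_
    have : ∀ N, n ≤ N → ∑ j ∈ Finset.Ico n N, (1 / 2 : ℝ) ^ j = 2 * (1 / 2) ^ n - 2 * (1 / 2) ^ N :=
      fun N hN => by
        induction N, hN using Nat.le_induction with
        | base => simp
        | succ k hk ih => rw [Finset.sum_Ico_succ_top hk, ih]; ring
    rw [this N hnN]
    have : (0 : ℝ) ≤ 2 * (1 / 2) ^ N := by positivity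
    linarith
  have hvB : besSeminorm p v < ∞ := by
    have h1 := besSeminorm_add_le hp.out (fun R => (hvLp R).sub ((u 0).memLp R)) (u 0).memLp
    rw [sub_add_cancel] at h1
    exact h1.trans_lt (ENNReal.add_lt_top.2
      ⟨(hest 0).trans_lt ENNReal.ofReal_lt_top, (u 0).besSeminorm_lt_top⟩)
  let V : Marcinkiewicz m p F := ⟨v, hvLp, hvB⟩
  refine ⟨V, ?_⟩
  rw [tendsto_iff_norm_sub_tendsto_zero]
  have h0 : Tendsto (fun n : ℕ => 2 * (1 / 2 : ℝ) ^ n) atTop (𝓝 (2 * 0)) :=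
    (tendsto_pow_atTop_nhds_zero_of_lt_one (by norm_num) (by norm_num)).const_mul 2
  rw [mul_zero] at h0
  refine squeeze_zero (fun _ => norm_nonneg _) (fun n => ?_) h0
  rw [norm_sub_rev, Marcinkiewicz.norm_def, Marcinkiewicz.fn_sub]
  exact ENNReal.toReal_le_of_le_ofReal (by positivity) (hest n)

theorem completeSpace_besicovitch {m : ℕ} (hm : 1 ≤ m) (A : Subalgebra ℝ (Euc m →ᵇ ℝ)) {p : ℝ≥0∞}
    [Fact (1 ≤ p)] (hp' : p ≠ ∞) (F : Type*) [NormedAddCommGroup F] [NormedSpace ℝ F] :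
    CompleteSpace (Besicovitch A p F) := by
  have := completeSpace_marcinkiewicz hm hp' (F := F)
  have h : CompleteSpace (besicovitchSubmodule A p F) :=
    (Submodule.isClosed_topologicalClosure _).completeSpace_coe
  exact SeparationQuotient.completeSpace_iff.2 h

/-! ### The mean value on an algebra with mean value -/

section Algebra

variable {m : ℕ} {A : Subalgebra ℝ (Euc m →ᵇ ℝ)}

lemma ballAverage_add {F : Type*} [NormedAddCommGroup F] [NormedSpace ℝ F] {w w' : Euc m → F}
    {R : ℝ} (hw : Integrable w (ballMean m R)) (hw' : Integrable w' (ballMean m R)) :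
    ballAverage (fun y => w y + w' y) R = ballAverage w R + ballAverage w' R :=
  integral_add hw hw'

lemma ballAverage_smul {F : Type*} [NormedAddCommGroup F] [NormedSpace ℝ F] (c : ℝ) (w : Euc m → F)
    (R : ℝ) : ballAverage (fun y => c • w y) R = c • ballAverage w R :=
  integral_smul c w

/-- The algebra `A` as a type of its own, with its structure of commutative `ℝ`-algebra. -/
def Alg (A : Subalgebra ℝ (Euc m →ᵇ ℝ)) : Type := A

instance : CommRing (Alg A) := inferInstanceAs (CommRing A)

instance : Algebra ℝ (Alg A) := inferInstanceAs (Algebra ℝ A)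

/-- The bounded continuous function underlying an element of the algebra. -/
def Alg.fn (a : Alg A) : Euc m →ᵇ ℝ := a.1

lemma Alg.fn_mem (a : Alg A) : a.fn ∈ A := a.2

/-- Evaluation at a point, as an algebra morphism. -/
def algEval (A : Subalgebra ℝ (Euc m →ᵇ ℝ)) (y : Euc m) : Alg A →ₐ[ℝ] ℝ where
  toFun a := a.fn y
  map_one' := rfl
  map_mul' _ _ := rfl
  map_zero' := rfl
  map_add' _ _ := rfl
  commutes' _ := rfl

lemma algEval_apply (a : Alg A) (y : Euc m) : algEval A y a = a.fn y := rfl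

lemma tendsto_ballAverage_meanValue (hA : IsAlgebraWithMeanValue A) (a : Alg A) :
    Tendsto (ballAverage a.fn) atTop (𝓝 (meanValue a.fn)) :=
  tendsto_nhds_limUnder (exists_tendsto_ballAverage hA a.fn_mem)

/-- The mean value as a linear form on the algebra. -/
def algMean (hA : IsAlgebraWithMeanValue A) : Alg A →ₗ[ℝ] ℝ where
  toFun a := meanValue a.fn
  map_add' a b := by
    refine tendsto_nhds_unique (tendsto_ballAverage_meanValue hA (a + b)) ?_
    refine ((tendsto_ballAverage_meanValue hA a).add
      (tendsto_ballAverage_meanValue hA b)).congr' ?_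
    filter_upwards [eventually_gt_atTop 0] with R hR
    exact (ballAverage_add (integrable_ballMean_bcf _ hR) (integrable_ballMean_bcf _ hR)).symm
  map_smul' c a := by
    refine tendsto_nhds_unique (tendsto_ballAverage_meanValue hA (c • a)) ?_
    exact ((tendsto_ballAverage_meanValue hA a).const_smul c).congr fun R =>
      (ballAverage_smul c _ R).symm

lemma tendsto_algMean (hA : IsAlgebraWithMeanValue A) (a : Alg A) :
    Tendsto (ballAverage a.fn) atTop (𝓝 (algMean hA a)) :=
  tendsto_ballAverage_meanValue hA a

lemma algMean_nonneg (hA : IsAlgebraWithMeanValue A) {a : Alg A} (ha : ∀ y, 0 ≤ a.fn y) :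
    0 ≤ algMean hA a :=
  ge_of_tendsto' (tendsto_algMean hA a) fun _ => integral_nonneg ha

lemma algMean_mono (hA : IsAlgebraWithMeanValue A) {a b : Alg A} (h : ∀ y, a.fn y ≤ b.fn y) :
    algMean hA a ≤ algMean hA b := by
  have := algMean_nonneg hA (a := b - a) fun y => sub_nonneg.2 (h y)
  rw [map_sub] at this
  linarith

/-- The weak-* limit of the rescaled functions is the limit of the averages over balls. -/
lemma tendsto_integral_comp_inv_smul (hA : IsAlgebraWithMeanValue A) (a : Alg A) {φ : Euc m → ℝ}
    (hφ : Integrable φ) :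
    Tendsto (fun ε : ℝ => ∫ x, a.fn (ε⁻¹ • x) * φ x) (𝓝[>] 0) (𝓝 (algMean hA a * ∫ x, φ x)) := by
  obtain ⟨M, hM⟩ := hA.mean_value a.fn a.fn_mem
  suffices h : algMean hA a = M by
    rw [h]
    exact hM φ hφ
  have hB : volume.real (ball (0 : Euc m) 1) ≠ 0 :=
    (ENNReal.toReal_pos (measure_ball_pos _ _ one_pos).ne' measure_ball_lt_top.ne).ne'
  -- Testing with the normalized indicator of the unit ball at ε = 1/R turns the weak-* limit into a
  -- limit of averages over B_R.
  have h1 := hM ((ball 0 1).indicator fun _ => (volume.real (ball (0 : Euc m) 1))⁻¹)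
    ((integrable_indicator_iff measurableSet_ball).2 (integrableOn_const measure_ball_lt_top.ne))
  have h2 := h1.comp tendsto_inv_atTop_nhdsGT_zero
  rw [integral_indicator measurableSet_ball, setIntegral_const, smul_eq_mul, mul_inv_cancel₀ hB,
    mul_one] at h2
  refine tendsto_nhds_unique (tendsto_algMean hA a) (h2.congr' ?_)
  filter_upwards [eventually_gt_atTop 0] with R hR
  have e : ∀ x : Euc m, a.fn ((R⁻¹)⁻¹ • x) * (ball (0 : Euc m) 1).indicator
      (fun _ => (volume.real (ball (0 : Euc m) 1))⁻¹) x
      = (ball (0 : Euc m) 1).indicator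
        (fun x => a.fn (R • x) * (volume.real (ball (0 : Euc m) 1))⁻¹) x := fun x => by
    by_cases hx : x ∈ ball (0 : Euc m) 1 <;> simp [hx]
  simp only [Function.comp_apply, e]
  rw [integral_indicator measurableSet_ball, integral_mul_const,
    Measure.setIntegral_comp_smul_of_pos _ _ _ hR, smul_unitBall_of_pos hR, ballAverage, ballMean,
    integral_smul_measure, ENNReal.toReal_inv, smul_eq_mul, smul_eq_mul,
    Measure.addHaar_ball_of_pos _ _ hR, ENNReal.toReal_mul, ENNReal.toReal_ofReal (by positivity),
    Measure.real, mul_inv]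
  ring

/-- A closed algebra of bounded functions is stable under the continuous functional calculus. -/
lemma exists_mem_comp (hA : IsClosed (A : Set (Euc m →ᵇ ℝ))) (Φ : C(ℝ, ℝ)) (a : Alg A) :
    ∃ b : Alg A, ∀ y, b.fn y = Φ (a.fn y) := by
  have hmem : ∀ y, a.fn y ∈ Set.Icc (-‖a.fn‖) ‖a.fn‖ := fun y => abs_le.1 (a.fn.norm_coe_le_norm y)
  obtain ⟨C, hC⟩ := (isCompact_Icc (a := -‖a.fn‖) (b := ‖a.fn‖)).exists_bound_of_continuousOn
    Φ.continuous.continuousOn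
  let b : Euc m →ᵇ ℝ := BoundedContinuousFunction.ofNormedAddCommGroup (fun y => Φ (a.fn y))
    (Φ.continuous.comp a.fn.continuous) C fun y => hC _ (hmem y)
  refine ⟨⟨b, ?_⟩, fun y => rfl⟩
  refine hA.closure_subset (Metric.mem_closure_iff.2 fun η hη => ?_)
  obtain ⟨P, hP⟩ := exists_polynomial_near_of_continuousOn (-‖a.fn‖) ‖a.fn‖ Φ
    Φ.continuous.continuousOn (η / 2) (by positivity)
  refine ⟨(Polynomial.aeval a P).fn, (Polynomial.aeval a P).fn_mem, ?_⟩
  refine lt_of_le_of_lt ((BoundedContinuousFunction.dist_le (by positivity)).2 fun y => ?_)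
    (half_lt_self hη)
  have h1 : (Polynomial.aeval a P).fn y = P.eval (a.fn y) := by
    rw [← Polynomial.coe_aeval_eq_eval]
    exact (Polynomial.aeval_algHom_apply (algEval A y) a P).symm
  rw [h1, dist_comm, Real.dist_eq]
  exact (hP _ (hmem y)).le

/-- The element `Φ ∘ a` of a closed algebra of bounded functions. -/
def algComp (hA : IsAlgebraWithMeanValue A) (Φ : C(ℝ, ℝ)) (a : Alg A) : Alg A :=
  (exists_mem_comp hA.isClosed Φ a).choose

lemma algComp_apply (hA : IsAlgebraWithMeanValue A) (Φ : C(ℝ, ℝ)) (a : Alg A) (y : Euc m) :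
    (algComp hA Φ a).fn y = Φ (a.fn y) :=
  (exists_mem_comp hA.isClosed Φ a).choose_spec y

end Algebra

/-! ### Integrals of simple functions with values in the algebra -/

section Simple

open SimpleFunc

lemma integrable_simpleFunc_comp {X E : Type*} [MeasurableSpace X] (ν : Measure X)
    [IsFiniteMeasure ν] (t : SimpleFunc X E) (g : E → ℝ) :
    Integrable (fun x => g (t x)) ν :=
  (t.map g).integrable_of_isFiniteMeasure

/-- The integral of a simple function with values in a vector space without topology. -/
def simpleInt {X E : Type*} [MeasurableSpace X] [AddCommGroup E] [Module ℝ E] (ν : Measure X)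
    (t : SimpleFunc X E) : E := ∑ a ∈ t.range, ν.real (t ⁻¹' {a}) • a

/-- Used with evaluation at a point and with the mean value: integrating an A-valued simple function
yields a single element of the algebra, to which the mean value property applies directly. No
topology on the algebra is involved. -/
lemma linearMap_simpleInt {X E : Type*} [MeasurableSpace X] [AddCommGroup E]
    [Module ℝ E] (ν : Measure X) [IsFiniteMeasure ν] (ℓ : E →ₗ[ℝ] ℝ) (t : SimpleFunc X E) :
    ℓ (simpleInt ν t) = ∫ x, ℓ (t x) ∂ν := by
  classical
  have h : ∀ x, ℓ (t x) = ∑ a ∈ t.range, (t ⁻¹' {a}).indicator (fun _ => ℓ a) x := fun x => by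
    rw [Finset.sum_eq_single_of_mem (t x) (t.mem_range_self x) fun b _ hb =>
      Set.indicator_of_notMem (fun hx => hb hx.symm) _]
    exact (Set.indicator_of_mem (rfl : t x = t x) _).symm
  simp only [h]
  rw [integral_finsetSum _ fun a _ => (integrable_const _).indicator (t.measurableSet_fiber a),
    simpleInt, map_sum]
  refine Finset.sum_congr rfl fun a _ => ?_
  rw [integral_indicator_const _ (t.measurableSet_fiber a), map_smul]

end Simple

/-! ### Simple functions as elements of the Lebesgue and Besicovitch spaces -/

section SimpleLp

lemma memLp_simpleFunc_comp {X E F : Type*} [MeasurableSpace X] [NormedAddCommGroup F] (r : ℝ≥0∞) (ν : Measure X) [IsFiniteMeasure ν] (T : E → F)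
    (s : SimpleFunc X E) : MemLp (fun x => T (s x)) r ν :=
  (s.map T).memLp_of_isFiniteMeasure r ν

lemma norm_rpow_Lp {X F : Type*} [MeasurableSpace X] [NormedAddCommGroup F] {r : ℝ≥0∞} (hr : 1 ≤ r) (hr' : r ≠ ∞) {ν : Measure X} (g : Lp F r ν) :
    ‖g‖ ^ r.toReal = ∫ x, ‖g x‖ ^ r.toReal ∂ν := by
  have hr0 : r ≠ 0 := (zero_lt_one.trans_le hr).ne'
  have hi : 0 ≤ ∫ x, ‖g x‖ ^ r.toReal ∂ν := integral_nonneg fun x => by positivity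
  rw [Lp.norm_def, (Lp.memLp g).eLpNorm_eq_integral_rpow_norm hr0 hr',
    ENNReal.toReal_ofReal (by positivity), ← Real.rpow_mul hi,
    inv_mul_cancel₀ (ENNReal.toReal_pos hr0 hr').ne', Real.rpow_one]

variable {X E F : Type*} [MeasurableSpace X] [AddCommGroup E] [Module ℝ E] [NormedAddCommGroup F]
  [NormedSpace ℝ F]

/-- The class in `L^r` of the composition of a simple function and a linear map. -/
def simpleLp (r : ℝ≥0∞) (ν : Measure X) [IsFiniteMeasure ν] (T : E →ₗ[ℝ] F) :
    SimpleFunc X E →ₗ[ℝ] Lp F r ν where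
  toFun s := (memLp_simpleFunc_comp r ν T s).toLp _
  map_add' s s' := by
    rw [← MemLp.toLp_add]
    congr 1
    funext x
    exact map_add T _ _
  map_smul' c s := by
    rw [RingHom.id_apply, ← MemLp.toLp_const_smul]
    congr 1
    funext x
    exact map_smul T _ _

lemma coeFn_simpleLp (r : ℝ≥0∞) (ν : Measure X) [IsFiniteMeasure ν] (T : E →ₗ[ℝ] F)
    (s : SimpleFunc X E) : simpleLp r ν T s =ᵐ[ν] fun x => T (s x) :=
  (memLp_simpleFunc_comp r ν T s).coeFn_toLp

lemma norm_rpow_simpleLp {r : ℝ≥0∞} (hr : 1 ≤ r) (hr' : r ≠ ∞) (ν : Measure X) [IsFiniteMeasure ν]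
    (T : E →ₗ[ℝ] F) (s : SimpleFunc X E) :
    ‖simpleLp r ν T s‖ ^ r.toReal = ∫ x, ‖T (s x)‖ ^ r.toReal ∂ν := by
  rw [norm_rpow_Lp hr hr']
  refine integral_congr_ae ?_
  filter_upwards [coeFn_simpleLp r ν T s] with x hx using by rw [hx]

end SimpleLp

section Embedding

variable {m : ℕ} {A : Subalgebra ℝ (Euc m →ᵇ ℝ)} {X F : Type*} [MeasurableSpace X]
  [NormedAddCommGroup F] [NormedSpace ℝ F]

/-- The function `y ↦ a(y) v` as an element of the vector-valued algebra. -/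
def vecAlgebraTensor (a : Alg A) (v : F) : vecAlgebra A F :=
  ⟨a.fn • BoundedContinuousFunction.const _ v,
    Submodule.le_topologicalClosure _ (Submodule.subset_span ⟨a.fn, a.fn_mem, v, fun _ => rfl⟩)⟩

lemma vecAlgebraTensor_apply (a : Alg A) (v : F) (y : Euc m) :
    (vecAlgebraTensor a v).1 y = a.fn y • v := rfl

/-- By linearity it suffices to treat an element a carried by a set s, which corresponds to the
tensor of a with the indicator of s. -/
lemma exists_vecAlgebra_eq_simpleLp (r : ℝ≥0∞) (ν : Measure X) [IsFiniteMeasure ν]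
    [Fact (1 ≤ r)] (t : SimpleFunc X (Alg A)) :
    ∃ g : vecAlgebra A (Lp ℝ r ν), ∀ y, g.1 y = simpleLp r ν (algEval A y).toLinearMap t := by
  induction t using SimpleFunc.induction with
  | @const a s hs =>
    refine ⟨vecAlgebraTensor a (indicatorConstLp r hs (measure_ne_top ν s) 1), fun y => ?_⟩
    rw [vecAlgebraTensor_apply]
    refine Lp.ext ?_
    filter_upwards [coeFn_simpleLp r ν (algEval A y).toLinearMap (SimpleFunc.piecewise s hs
      (SimpleFunc.const X a) (SimpleFunc.const X 0)),
      Lp.coeFn_smul (a.fn y) (indicatorConstLp r hs (measure_ne_top ν s) (1 : ℝ)),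
      indicatorConstLp_coeFn (p := r) (hs := hs) (hμs := measure_ne_top ν s) (c := (1 : ℝ))]
      with x h1 h2 h3
    rw [h1, h2, Pi.smul_apply, h3]
    by_cases hx : x ∈ s
    · simp [hx, algEval_apply]
    · simp [hx]
  | @add f g _ hf hg =>
    obtain ⟨f', hf'⟩ := hf
    obtain ⟨g', hg'⟩ := hg
    refine ⟨f' + g', fun y => ?_⟩
    rw [map_add, ← hf', ← hg']
    rfl

/-- A simple function with values in the algebra, as an element of the vector-valued algebra. -/
def simpleEmb (A : Subalgebra ℝ (Euc m →ᵇ ℝ)) (r : ℝ≥0∞) (ν : Measure X) [IsFiniteMeasure ν]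
    [Fact (1 ≤ r)] : SimpleFunc X (Alg A) →ₗ[ℝ] vecAlgebra A (Lp ℝ r ν) where
  toFun t := (exists_vecAlgebra_eq_simpleLp r ν t).choose
  map_add' t t' := Subtype.ext <| BoundedContinuousFunction.ext fun y => by
    rw [(exists_vecAlgebra_eq_simpleLp r ν (t + t')).choose_spec y, map_add,
      ← (exists_vecAlgebra_eq_simpleLp r ν t).choose_spec y,
      ← (exists_vecAlgebra_eq_simpleLp r ν t').choose_spec y]
    rfl
  map_smul' c t := Subtype.ext <| BoundedContinuousFunction.ext fun y => by
    rw [(exists_vecAlgebra_eq_simpleLp r ν (c • t)).choose_spec y, map_smul,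
      ← (exists_vecAlgebra_eq_simpleLp r ν t).choose_spec y]
    rfl

lemma simpleEmb_apply (r : ℝ≥0∞) (ν : Measure X) [IsFiniteMeasure ν] [Fact (1 ≤ r)]
    (t : SimpleFunc X (Alg A)) (y : Euc m) :
    (simpleEmb A r ν t).1 y = simpleLp r ν (algEval A y).toLinearMap t :=
  (exists_vecAlgebra_eq_simpleLp r ν t).choose_spec y

variable {p : ℝ≥0∞} [hp : Fact (1 ≤ p)]

/-- The quotient map onto the normed Besicovitch space. -/
def besMk (A : Subalgebra ℝ (Euc m →ᵇ ℝ)) (p : ℝ≥0∞) [Fact (1 ≤ p)] (F : Type*)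
    [NormedAddCommGroup F] [NormedSpace ℝ F] : besicovitchSubmodule A p F →ₗ[ℝ] Besicovitch A p F :=
  (SeparationQuotient.mkCLM ℝ (besicovitchSubmodule A p F)).toLinearMap

lemma besMk_surjective : Function.Surjective (besMk A p F) :=
  SeparationQuotient.surjective_mk

lemma norm_besMk (w : besicovitchSubmodule A p F) : ‖besMk A p F w‖ = ‖w.1‖ :=
  SeparationQuotient.norm_mk w

/-- The elements of the vector-valued algebra as elements of the Besicovitch space. -/
def vecAlgebraToBes (A : Subalgebra ℝ (Euc m →ᵇ ℝ)) (p : ℝ≥0∞) [Fact (1 ≤ p)] (F : Type*)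
    [NormedAddCommGroup F] [NormedSpace ℝ F] : vecAlgebra A F →ₗ[ℝ] Besicovitch A p F :=
  besMk A p F ∘ₗ (ofBCF.comp (vecAlgebra A F).subtype).codRestrict (besicovitchSubmodule A p F)
    fun g => Submodule.le_topologicalClosure _ (Submodule.mem_map_of_mem g.2)

/-- When the averages of the p-th powers converge, the limsup in the seminorm is a limit, and taking
p-th roots is continuous. -/
lemma norm_rpow_ofBCF (hp' : p ≠ ∞) (g : Euc m →ᵇ F) {l : ℝ}
    (h : Tendsto (ballAverage fun y => ‖g y‖ ^ p.toReal) atTop (𝓝 l)) :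
    ‖(ofBCF g : Marcinkiewicz m p F)‖ ^ p.toReal = l := by
  have hp0 : p ≠ 0 := (zero_lt_one.trans_le hp.out).ne'
  have hpp := ENNReal.toReal_pos hp0 hp'
  have hl : 0 ≤ l := ge_of_tendsto' h fun _ => integral_nonneg fun y => by positivity
  have h1 : Tendsto (fun R => eLpNorm g p (ballMean m R)) atTop
      (𝓝 (ENNReal.ofReal (l ^ p.toReal⁻¹))) := by
    have h2 := ENNReal.tendsto_ofReal
      (h.rpow_const (p := p.toReal⁻¹) (Or.inr (inv_nonneg.2 hpp.le)))
    refine h2.congr' ?_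
    filter_upwards [eventually_gt_atTop 0] with R hR
    exact ((memLp_ballMean hR ((bcf_mem_marcinkiewicz (p := p) g).1 R)).eLpNorm_eq_integral_rpow_norm
      hp0 hp').symm
  have h3 : besSeminorm p (ofBCF g : Marcinkiewicz m p F).fn = ENNReal.ofReal (l ^ p.toReal⁻¹) :=
    h1.limsup_eq
  rw [Marcinkiewicz.norm_def, h3, ENNReal.toReal_ofReal (by positivity), ← Real.rpow_mul hl,
    inv_mul_cancel₀ hpp.ne', Real.rpow_one]

/-- The function `|a|^r` on the real line. -/
def absRpow (r : ℝ) : C(ℝ, ℝ) where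
  toFun a := |a| ^ (max r 0)
  continuous_toFun := continuous_abs.rpow_const fun _ => Or.inr (le_max_right _ _)

lemma absRpow_apply {r : ℝ} (hr : 0 ≤ r) (a : ℝ) : absRpow r a = |a| ^ r := by
  rw [absRpow, ContinuousMap.coe_mk, max_eq_left hr]

/-- Averages of the integrals of a simple function with values in the algebra. -/
lemma tendsto_ballAverage_integral (hA : IsAlgebraWithMeanValue A) (ν : Measure X)
    [IsFiniteMeasure ν] (t : SimpleFunc X (Alg A)) :
    Tendsto (ballAverage fun y => ∫ x, (t x).fn y ∂ν) atTop (𝓝 (∫ x, algMean hA (t x) ∂ν)) := by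
  rw [← linearMap_simpleInt]
  have h : (fun y => ∫ x, (t x).fn y ∂ν) = (simpleInt ν t).fn := by
    funext y
    exact (linearMap_simpleInt ν (algEval A y).toLinearMap t).symm
  rw [h]
  exact tendsto_algMean hA _

/-- Stability of the algebra under |·|^p makes the mean value of each |t x|^p exist; the Besicovitch
norm thus becomes an integral of mean values. -/
lemma norm_rpow_vecAlgebraToBes_simpleEmb (hA : IsAlgebraWithMeanValue A) (hp' : p ≠ ∞)
    (ν : Measure X) [IsFiniteMeasure ν] (t : SimpleFunc X (Alg A)) :
    ‖vecAlgebraToBes A p _ (simpleEmb A p ν t)‖ ^ p.toReal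
      = ∫ x, algMean hA (algComp hA (absRpow p.toReal) (t x)) ∂ν := by
  rw [vecAlgebraToBes, LinearMap.comp_apply, norm_besMk]
  refine norm_rpow_ofBCF hp' (simpleEmb A p ν t).1 ?_
  have h := tendsto_ballAverage_integral hA ν (t.map (algComp hA (absRpow p.toReal)))
  have e : (fun y => ‖(simpleEmb A p ν t).1 y‖ ^ p.toReal) = fun y =>
      ∫ x, (t.map (algComp hA (absRpow p.toReal)) x).fn y ∂ν := by
    funext y
    rw [simpleEmb_apply, norm_rpow_simpleLp hp.out hp']
    refine integral_congr_ae (Eventually.of_forall fun x => ?_)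
    simp only [SimpleFunc.map_apply, algComp_apply, absRpow_apply ENNReal.toReal_nonneg]
    rfl
  rw [e]
  exact h

end Embedding

/-! ### The mean value of a product as a bounded bilinear map -/

section Pairing

variable {m : ℕ} {A : Subalgebra ℝ (Euc m →ᵇ ℝ)} {p : ℝ≥0∞} [hp : Fact (1 ≤ p)]
  {F₁ F₂ F : Type*} [NormedAddCommGroup F₁] [NormedSpace ℝ F₁] [NormedAddCommGroup F₂]
  [NormedSpace ℝ F₂]

lemma integrable_ballMean_bilin (T : F₁ →L[ℝ] F₂ →L[ℝ] ℝ)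
    (w : besicovitchSubmodule A p F₁) (f : vecAlgebra A F₂) {R : ℝ} (hR : 0 < R) :
    Integrable (fun y => T (w.1.fn y) (f.1 y)) (ballMean m R) :=
  integrable_bilin T (integrable_ballMean_of_memLp hp.out hR (w.1.memLp R)) f.1

/-- Comparison of w with 0 bounds the averages eventually by any δ > ‖w‖ in place of ‖w‖; then δ
decreases to ‖w‖. -/
lemma norm_meanValue_bilin_le (hA : IsAlgebraWithMeanValue A) (T : F₁ →L[ℝ] F₂ →L[ℝ] ℝ)
    (w : besicovitchSubmodule A p F₁) (f : vecAlgebra A F₂) :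
    ‖meanValue fun y => T (w.1.fn y) (f.1 y)‖ ≤ ‖T‖ * ‖w.1‖ * ‖f‖ := by
  have hlim := (tendsto_ballAverage_bilin hA T w f).norm
  have hδ : ∀ δ, ‖w.1‖ < δ → ‖meanValue fun y => T (w.1.fn y) (f.1 y)‖ ≤ ‖T‖ * ‖f.1‖ * δ := by
    intro δ hδ
    refine le_of_tendsto hlim ?_
    have h := eventually_norm_ballAverage_sub_le T w.1 0 f.1 (by rwa [sub_zero])
    filter_upwards [h] with R hR
    have h0 : ballAverage (fun y => T ((0 : Marcinkiewicz m p F₁).fn y) (f.1 y)) R = 0 := by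
      have : ∀ y, (0 : Marcinkiewicz m p F₁).fn y = 0 := fun _ => rfl
      simp [ballAverage, this]
    rwa [h0, sub_zero] at hR
  have h2 : Tendsto (fun δ => ‖T‖ * ‖f.1‖ * δ) (𝓝[>] ‖w.1‖) (𝓝 (‖T‖ * ‖f.1‖ * ‖w.1‖)) :=
    ((continuous_const.mul continuous_id).tendsto _).mono_left nhdsWithin_le_nhds
  refine (ge_of_tendsto h2 (eventually_mem_nhdsWithin.mono hδ)).trans (le_of_eq ?_)
  rw [Submodule.coe_norm]
  ring

/-- The mean value of `y ↦ T (w y) (f y)`, as a bilinear form on representatives. -/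
def meanPairingAux (hA : IsAlgebraWithMeanValue A) (T : F₁ →L[ℝ] F₂ →L[ℝ] ℝ) :
    besicovitchSubmodule A p F₁ →ₗ[ℝ] vecAlgebra A F₂ →ₗ[ℝ] ℝ :=
  LinearMap.mk₂ ℝ (fun w f => meanValue fun y => T (w.1.fn y) (f.1 y))
    (fun w w' f => by
      refine tendsto_nhds_unique (tendsto_ballAverage_bilin hA T (w + w') f) ?_
      refine ((tendsto_ballAverage_bilin hA T w f).add
        (tendsto_ballAverage_bilin hA T w' f)).congr' ?_
      filter_upwards [eventually_gt_atTop 0] with R hR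
      rw [← ballAverage_add (integrable_ballMean_bilin T w f hR)
        (integrable_ballMean_bilin T w' f hR)]
      congr 1
      funext y
      rw [Submodule.coe_add, Marcinkiewicz.fn_add, Pi.add_apply, map_add]
      rfl)
    (fun c w f => by
      refine tendsto_nhds_unique (tendsto_ballAverage_bilin hA T (c • w) f) ?_
      refine ((tendsto_ballAverage_bilin hA T w f).const_smul c).congr fun R => ?_
      rw [← ballAverage_smul]
      congr 1
      funext y
      rw [Submodule.coe_smul, Marcinkiewicz.fn_smul, Pi.smul_apply, map_smul]
      rfl)
    (fun w f f' => by
      refine tendsto_nhds_unique (tendsto_ballAverage_bilin hA T w (f + f')) ?_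
      refine ((tendsto_ballAverage_bilin hA T w f).add
        (tendsto_ballAverage_bilin hA T w f')).congr' ?_
      filter_upwards [eventually_gt_atTop 0] with R hR
      rw [← ballAverage_add (integrable_ballMean_bilin T w f hR)
        (integrable_ballMean_bilin T w f' hR)]
      congr 1
      funext y
      rw [Submodule.coe_add, BoundedContinuousFunction.add_apply, map_add])
    (fun c w f => by
      refine tendsto_nhds_unique (tendsto_ballAverage_bilin hA T w (c • f)) ?_
      refine ((tendsto_ballAverage_bilin hA T w f).const_smul c).congr fun R => ?_
      rw [← ballAverage_smul]
      congr 1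
      funext y
      rw [Submodule.coe_smul, BoundedContinuousFunction.smul_apply, map_smul])

/-- The mean value of `y ↦ T (v y) (f y)`, as a bounded bilinear form. -/
def meanPairing (hA : IsAlgebraWithMeanValue A) (T : F₁ →L[ℝ] F₂ →L[ℝ] ℝ) :
    Besicovitch A p F₁ →L[ℝ] vecAlgebra A F₂ →L[ℝ] ℝ :=
  LinearMap.mkContinuous₂
    (LinearMap.mk₂ ℝ (fun (v : Besicovitch A p F₁) (f : vecAlgebra A F₂) =>
        SeparationQuotient.lift (fun w : besicovitchSubmodule A p F₁ => meanPairingAux hA T w f)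
          (fun w w' h => meanValue_bilin_congr T w.1 w'.1 f.1 (by
            rw [Metric.inseparable_iff, Subtype.dist_eq, dist_eq_norm] at h
            exact h)) v)
      (fun v v' f => by
        obtain ⟨w, rfl⟩ := besMk_surjective v
        obtain ⟨w', rfl⟩ := besMk_surjective v'
        rw [← map_add]
        exact (meanPairingAux hA T).map_add₂ w w' f)
      (fun c v f => by
        obtain ⟨w, rfl⟩ := besMk_surjective v
        rw [← map_smul]
        exact (meanPairingAux hA T).map_smul₂ c w f)
      (fun v f f' => by
        obtain ⟨w, rfl⟩ := besMk_surjective v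
        exact (meanPairingAux hA T w).map_add f f')
      (fun c v f => by
        obtain ⟨w, rfl⟩ := besMk_surjective v
        exact (meanPairingAux hA T w).map_smul c f))
    ‖T‖ (fun v f => by
      obtain ⟨w, rfl⟩ := besMk_surjective v
      rw [norm_besMk]
      exact norm_meanValue_bilin_le hA T w f)

lemma meanPairing_besMk (hA : IsAlgebraWithMeanValue A) (T : F₁ →L[ℝ] F₂ →L[ℝ] ℝ)
    (w : besicovitchSubmodule A p F₁) (f : vecAlgebra A F₂) :
    meanPairing hA T (besMk A p F₁ w) f = meanValue fun y => T (w.1.fn y) (f.1 y) := rfl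

/-- The mean value of the product of two simple functions. -/
lemma meanPairing_simpleEmb (hA : IsAlgebraWithMeanValue A) {q : ℝ≥0∞} [Fact (1 ≤ q)]
    [p.HolderConjugate q] {X : Type*} [MeasurableSpace X] (ν : Measure X) [IsFiniteMeasure ν]
    (t t' : SimpleFunc X (Alg A)) :
    meanPairing hA ((ContinuousLinearMap.mul ℝ ℝ).lpPairing ν p q)
      (vecAlgebraToBes A p _ (simpleEmb A p ν t)) (simpleEmb A q ν t')
      = ∫ x, algMean hA (t x * t' x) ∂ν := by
  rw [vecAlgebraToBes, LinearMap.comp_apply, meanPairing_besMk]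
  refine tendsto_nhds_unique (tendsto_ballAverage_bilin hA _ _ _) ?_
  have h := tendsto_ballAverage_integral hA ν (t * t')
  refine h.congr fun R => ?_
  congr 1
  funext y
  rw [ContinuousLinearMap.lpPairing_eq_integral]
  symm
  change ∫ x, ContinuousLinearMap.mul ℝ ℝ ((simpleEmb A p ν t).1 y x) ((simpleEmb A q ν t').1 y x) ∂ν
    = _
  rw [simpleEmb_apply, simpleEmb_apply]
  refine integral_congr_ae ?_
  filter_upwards [coeFn_simpleLp p ν (algEval A y).toLinearMap t,
    coeFn_simpleLp q ν (algEval A y).toLinearMap t'] with x h1 h2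
  rw [h1, h2]
  rfl

/-- Integration over G₂ is a continuous linear form on L¹(G₂). It therefore commutes both with the
ball averages and with their limit, and turns the pointwise product into the scalar pairing of L^p
and L^q. -/
lemma integral_meanProduct_of_besMk_eq (hA : IsAlgebraWithMeanValue A) {q : ℝ≥0∞} [Fact (1 ≤ q)]
    [p.HolderConjugate q] {d₂ : ℕ} {G₂ : Set (Euc d₂)} (v : Besicovitch A p (LpOn p G₂))
    (f : vecAlgebra A (LpOn q G₂)) {w : besicovitchSubmodule A p (LpOn p G₂)}
    (hw : besMk A p (LpOn p G₂) w = v) :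
    ∫ ζ in G₂, meanProduct v f ζ
      = meanPairing hA ((ContinuousLinearMap.mul ℝ ℝ).lpPairing (volume.restrict G₂) p q) v f := by
  rw [← hw, meanPairing_besMk]
  change ∫ ζ in G₂, (meanValue fun y => lpMul p q G₂ (w.1.fn y) (f.1 y)) ζ = _
  have h2 := tendsto_ballAverage_bilin hA
    ((ContinuousLinearMap.mul ℝ ℝ).lpPairing (volume.restrict G₂) p q) w f
  have h := tendsto_ballAverage_bilin hA (lpMul p q G₂) w f
  obtain ⟨Λ, hΛ⟩ : ∃ Λ : LpOn 1 G₂ →L[ℝ] ℝ, ∀ g, Λ g = ∫ ζ in G₂, g ζ :=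
    ⟨L1.integralCLM, fun g => by rw [← L1.integral_eq, L1.integral_eq_integral]⟩
  have h1 := (Λ.continuous.tendsto _).comp h
  rw [hΛ] at h1
  refine tendsto_nhds_unique (h1.congr' ?_) h2
  filter_upwards [eventually_gt_atTop 0] with R hR
  rw [Function.comp_apply, ballAverage, ← ContinuousLinearMap.integral_comp_comm _
    (integrable_bilin _ (integrable_ballMean_of_memLp hp.out hR (w.1.memLp R)) f.1)]
  refine integral_congr_ae (Eventually.of_forall fun y => ?_)
  dsimp only
  rw [hΛ, ContinuousLinearMap.lpPairing_eq_integral]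
  exact integral_congr_ae (ContinuousLinearMap.coeFn_holder _ _ _)

lemma integral_meanProduct (hA : IsAlgebraWithMeanValue A) {q : ℝ≥0∞} [Fact (1 ≤ q)]
    [p.HolderConjugate q] {d₂ : ℕ} {G₂ : Set (Euc d₂)} (v : Besicovitch A p (LpOn p G₂))
    (f : vecAlgebra A (LpOn q G₂)) :
    ∫ ζ in G₂, meanProduct v f ζ
      = meanPairing hA ((ContinuousLinearMap.mul ℝ ℝ).lpPairing (volume.restrict G₂) p q) v f :=
  (besMk_surjective v).elim fun _ hw => integral_meanProduct_of_besMk_eq hA v f hw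

end Pairing

/-! ### Integrals over a product against functions with values in `L^q` -/

section Product

variable {Y X : Type*} [MeasurableSpace Y] [MeasurableSpace X] {μ : Measure Y} {ν : Measure X}
  {p q : ℝ≥0∞}

/-- The `L^p` norms of the sections of a function on a product. -/
lemma lintegral_eLpNorm_rpow_prod [SFinite ν] (hp : 1 ≤ p) (hp' : p ≠ ∞) {w : Y × X → ℝ}
    (hw : AEStronglyMeasurable w (μ.prod ν)) :
    ∫⁻ y, eLpNorm (fun x => w (y, x)) p ν ^ p.toReal ∂μ = eLpNorm w p (μ.prod ν) ^ p.toReal := by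
  have hp0 : p ≠ 0 := (zero_lt_one.trans_le hp).ne'
  have hpp := (ENNReal.toReal_pos hp0 hp').ne'
  simp only [eLpNorm_eq_lintegral_rpow_enorm_toReal hp0 hp', ← ENNReal.rpow_mul]
  simp only [one_div, inv_mul_cancel₀ hpp, ENNReal.rpow_one]
  exact (lintegral_prod _ (hw.enorm.pow_const _)).symm

lemma aemeasurable_eLpNorm_section [SFinite ν] (hp : 1 ≤ p) (hp' : p ≠ ∞) {w : Y × X → ℝ}
    (hw : AEStronglyMeasurable w (μ.prod ν)) :
    AEMeasurable (fun y => eLpNorm (fun x => w (y, x)) p ν) μ := by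
  have hp0 : p ≠ 0 := (zero_lt_one.trans_le hp).ne'
  simp only [eLpNorm_eq_lintegral_rpow_enorm_toReal hp0 hp']
  exact ((hw.enorm.pow_const p.toReal).lintegral_prod_right').pow_const _

lemma ae_memLp_section [SFinite ν] (hp : 1 ≤ p) (hp' : p ≠ ∞) {w : Y × X → ℝ} (hw : MemLp w p (μ.prod ν)) :
    ∀ᵐ y ∂μ, MemLp (fun x => w (y, x)) p ν := by
  have hp0 : p ≠ 0 := (zero_lt_one.trans_le hp).ne'
  have hpp := ENNReal.toReal_pos hp0 hp'
  have h1 := lintegral_eLpNorm_rpow_prod hp hp' hw.1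
  have h2 := ae_lt_top' ((aemeasurable_eLpNorm_section hp hp' hw.1).pow_const p.toReal) (by
    rw [h1]; exact (ENNReal.rpow_lt_top_of_nonneg hpp.le hw.eLpNorm_ne_top).ne)
  filter_upwards [hw.1.prodMk_left, h2] with y h3 h4
  exact ⟨h3, (ENNReal.rpow_lt_top_iff_of_pos hpp).1 h4⟩

lemma enorm_integral_mul_le [p.HolderConjugate q] {w : X → ℝ} (hw : AEStronglyMeasurable w ν)
    (g : Lp ℝ q ν) : ‖∫ x, w x * g x ∂ν‖ₑ ≤ eLpNorm w p ν * ‖g‖ₑ := by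
  calc ‖∫ x, w x * g x ∂ν‖ₑ ≤ ∫⁻ x, ‖w x * g x‖ₑ ∂ν := enorm_integral_le_lintegral_enorm _
    _ = eLpNorm (w • (g : X → ℝ)) 1 ν := by rw [eLpNorm_one_eq_lintegral_enorm]; rfl
    _ ≤ eLpNorm w p ν * eLpNorm g q ν :=
        eLpNorm_smul_le_mul_eLpNorm (Lp.aestronglyMeasurable g) hw
    _ = _ := by rw [Lp.enorm_def]

lemma integral_mul_eq_lpPairing [Fact (1 ≤ p)] [Fact (1 ≤ q)] [p.HolderConjugate q] {w : X → ℝ}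
    (hw : MemLp w p ν) (g : Lp ℝ q ν) :
    ∫ x, w x * g x ∂ν = (ContinuousLinearMap.mul ℝ ℝ).lpPairing ν p q (hw.toLp w) g := by
  rw [ContinuousLinearMap.lpPairing_eq_integral]
  refine integral_congr_ae ?_
  filter_upwards [hw.coeFn_toLp] with x hx
  rw [hx]
  rfl

lemma aestronglyMeasurable_simpleFunc_Lp (s : SimpleFunc Y (Lp ℝ q ν)) :
    StronglyMeasurable fun z : Y × X => s z.1 z.2 := by
  classical
  have h : (fun z : Y × X => s z.1 z.2) = fun z => ∑ c ∈ s.range,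
      ((s ⁻¹' {c}) ×ˢ (Set.univ : Set X)).indicator (fun z => c z.2) z := by
    funext z
    rw [Finset.sum_eq_single_of_mem (s z.1) (s.mem_range_self z.1) fun b _ hb =>
      Set.indicator_of_notMem (fun hx => hb hx.1.symm) _]
    rw [Set.indicator_of_mem]
    exact ⟨rfl, Set.mem_univ _⟩
  rw [h]
  refine Finset.stronglyMeasurable_fun_sum _ fun c _ => StronglyMeasurable.indicator ?_
    ((s.measurableSet_fiber c).prod MeasurableSet.univ)
  exact (Lp.stronglyMeasurable c).comp_measurable measurable_snd

/-- The value of h at y is only a class, so (y, x) ↦ h y x need not be jointly measurable. Simple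
approximations of h are jointly measurable, and continuity of the pairing passes to the limit for
almost every y. -/
lemma aestronglyMeasurable_integral_mul_Lp [SFinite ν] [Fact (1 ≤ p)] [Fact (1 ≤ q)] [p.HolderConjugate q]
    (hp' : p ≠ ∞) {w : Y × X → ℝ} (hw : MemLp w p (μ.prod ν)) {h : Y → Lp ℝ q ν}
    (hh : AEStronglyMeasurable h μ) :
    AEStronglyMeasurable (fun y => ∫ x, w (y, x) * h y x ∂ν) μ := by
  have hp : 1 ≤ p := Fact.out
  set s := hh.stronglyMeasurable_mk.approx
  refine aestronglyMeasurable_of_tendsto_ae atTop (f := fun k y => ∫ x, w (y, x) * s k y x ∂ν)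
    (fun k => ?_) ?_
  · exact (hw.1.mul
      (aestronglyMeasurable_simpleFunc_Lp (s k)).aestronglyMeasurable).integral_prod_right'
  · filter_upwards [ae_memLp_section hp hp' hw, hh.ae_eq_mk] with y h1 h2
    rw [h2]
    simp only [integral_mul_eq_lpPairing h1]
    exact (((ContinuousLinearMap.mul ℝ ℝ).lpPairing ν p q (h1.toLp _)).continuous.tendsto _).comp
      (hh.stronglyMeasurable_mk.tendsto_approx y)

/-- Hölder's inequality twice: in x on almost every section, then in y. -/
lemma lintegral_enorm_integral_mul_Lp_le [SFinite ν] [Fact (1 ≤ p)] [Fact (1 ≤ q)] [p.HolderConjugate q]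
    (hp' : p ≠ ∞) (hq' : q ≠ ∞) {w : Y × X → ℝ} (hw : MemLp w p (μ.prod ν)) {h : Y → Lp ℝ q ν}
    (hh : AEStronglyMeasurable h μ) :
    ∫⁻ y, ‖∫ x, w (y, x) * h y x ∂ν‖ₑ ∂μ ≤ eLpNorm w p (μ.prod ν) * eLpNorm h q μ := by
  have hp : 1 ≤ p := Fact.out
  have hq : 1 ≤ q := Fact.out
  have hp0 : p ≠ 0 := (zero_lt_one.trans_le hp).ne'
  have hq0 : q ≠ 0 := (zero_lt_one.trans_le hq).ne'
  have hpp := (ENNReal.toReal_pos hp0 hp').ne'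
  have hpq := ENNReal.HolderConjugate.toReal_of_ne_top hp' hq'
  calc ∫⁻ y, ‖∫ x, w (y, x) * h y x ∂ν‖ₑ ∂μ
      ≤ ∫⁻ y, ((fun y => eLpNorm (fun x => w (y, x)) p ν) * fun y => ‖h y‖ₑ) y ∂μ := by
        refine lintegral_mono_ae ?_
        filter_upwards [hw.1.prodMk_left] with y hy using enorm_integral_mul_le hy (h y)
    _ ≤ _ := ENNReal.lintegral_mul_le_Lp_mul_Lq μ hpq
        (aemeasurable_eLpNorm_section hp hp' hw.1) hh.enorm
    _ = _ := by
        rw [lintegral_eLpNorm_rpow_prod hp hp' hw.1, ← ENNReal.rpow_mul, mul_one_div_cancel hpp,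
          ENNReal.rpow_one, eLpNorm_eq_lintegral_rpow_enorm_toReal hq0 hq']

lemma integrable_integral_mul_Lp [SFinite ν] [Fact (1 ≤ p)] [Fact (1 ≤ q)] [p.HolderConjugate q]
    (hp' : p ≠ ∞) (hq' : q ≠ ∞) {w : Y × X → ℝ} (hw : MemLp w p (μ.prod ν)) {h : Y → Lp ℝ q ν}
    (hh : MemLp h q μ) : Integrable (fun y => ∫ x, w (y, x) * h y x ∂ν) μ :=
  ⟨aestronglyMeasurable_integral_mul_Lp hp' hw hh.1,
    (lintegral_enorm_integral_mul_Lp_le hp' hq' hw hh.1).trans_lt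
      (ENNReal.mul_lt_top hw.eLpNorm_lt_top hh.eLpNorm_lt_top)⟩

lemma norm_integral_mul_Lp_le [SFinite ν] [Fact (1 ≤ p)] [Fact (1 ≤ q)] [p.HolderConjugate q]
    (hp' : p ≠ ∞) (hq' : q ≠ ∞) {w : Y × X → ℝ} (hw : MemLp w p (μ.prod ν)) {h : Y → Lp ℝ q ν}
    (hh : MemLp h q μ) :
    ‖∫ y, ∫ x, w (y, x) * h y x ∂ν ∂μ‖
      ≤ (eLpNorm w p (μ.prod ν)).toReal * (eLpNorm h q μ).toReal := by
  rw [← ENNReal.toReal_mul, ← toReal_enorm]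
  exact ENNReal.toReal_mono
    (ENNReal.mul_lt_top hw.eLpNorm_lt_top hh.eLpNorm_lt_top).ne
    ((enorm_integral_le_lintegral_enorm _).trans
      (lintegral_enorm_integral_mul_Lp_le hp' hq' hw hh.1))

end Product

/-! ### The linear forms given by oscillating test functions -/

section SigmaForm

variable {m : ℕ} {A : Subalgebra ℝ (Euc m →ᵇ ℝ)} {X : Type*} [MeasurableSpace X]
  {μ : Measure (Euc m)} {ν : Measure X} {p q : ℝ≥0∞}

/-- The trace `y ↦ f(y, c y)`. -/
def diagTrace {F : Type*} [NormedAddCommGroup F] [NormedSpace ℝ F] (c : ℝ)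
    (f : Euc m → vecAlgebra A F) (y : Euc m) : F := (f y).1 (c • y)

lemma norm_diagTrace_le {F : Type*} [NormedAddCommGroup F] [NormedSpace ℝ F] (c : ℝ)
    (f : Euc m → vecAlgebra A F) (y : Euc m) : ‖diagTrace c f y‖ ≤ ‖f y‖ :=
  (f y).1.norm_coe_le_norm _

lemma memLp_diagTrace {F : Type*} [NormedAddCommGroup F] [NormedSpace ℝ F] (c : ℝ)
    {f : Euc m → vecAlgebra A F} (hf : MemLp f q μ) : MemLp (diagTrace c f) q μ := by
  refine hf.mono ?_ (Eventually.of_forall fun y => norm_diagTrace_le c f y)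
  -- Evaluation is jointly continuous in the function and the point, so the trace on the oscillating
  -- graph is measurable without any separability.
  have h1 : AEStronglyMeasurable (fun y => ((f y).1, c • y)) μ :=
    (continuous_subtype_val.comp_aestronglyMeasurable hf.1).prodMk
      (continuous_const_smul c).aestronglyMeasurable
  exact continuous_eval.comp_aestronglyMeasurable h1

lemma diagTrace_add {F : Type*} [NormedAddCommGroup F] [NormedSpace ℝ F] (c : ℝ)
    {f g k : Euc m → vecAlgebra A F} {y : Euc m} (h : k y = f y + g y) :
    diagTrace c k y = diagTrace c f y + diagTrace c g y := by
  rw [diagTrace, h]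
  rfl

lemma diagTrace_smul {F : Type*} [NormedAddCommGroup F] [NormedSpace ℝ F] (c a : ℝ)
    {f k : Euc m → vecAlgebra A F} {y : Euc m} (h : k y = a • f y) :
    diagTrace c k y = a • diagTrace c f y := by
  rw [diagTrace, h]
  rfl

lemma ae_integral_mul_diagTrace_add [SFinite ν] [Fact (1 ≤ p)] [Fact (1 ≤ q)] [p.HolderConjugate q]
    (hp' : p ≠ ∞) {w : Euc m × X → ℝ} (hw : MemLp w p (μ.prod ν)) (c : ℝ)
    {f g k : Euc m → vecAlgebra A (Lp ℝ q ν)} (h : k =ᵐ[μ] f + g) :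
    ∀ᵐ y ∂μ, ∫ x, w (y, x) * diagTrace c k y x ∂ν
      = ∫ x, w (y, x) * diagTrace c f y x ∂ν + ∫ x, w (y, x) * diagTrace c g y x ∂ν := by
  filter_upwards [ae_memLp_section Fact.out hp' hw, h] with y h1 h2
  rw [diagTrace_add c h2, integral_mul_eq_lpPairing h1, integral_mul_eq_lpPairing h1,
    integral_mul_eq_lpPairing h1, map_add]

lemma ae_integral_mul_diagTrace_smul [SFinite ν] [Fact (1 ≤ p)] [Fact (1 ≤ q)]
    [p.HolderConjugate q] (hp' : p ≠ ∞) {w : Euc m × X → ℝ} (hw : MemLp w p (μ.prod ν)) (c a : ℝ)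
    {f k : Euc m → vecAlgebra A (Lp ℝ q ν)} (h : k =ᵐ[μ] a • f) :
    ∀ᵐ y ∂μ, ∫ x, w (y, x) * diagTrace c k y x ∂ν = a * ∫ x, w (y, x) * diagTrace c f y x ∂ν := by
  filter_upwards [ae_memLp_section Fact.out hp' hw, h] with y h1 h2
  rw [diagTrace_smul c a h2, integral_mul_eq_lpPairing h1, integral_mul_eq_lpPairing h1, map_smul,
    smul_eq_mul]

/-- The linear form `f ↦ ∫ ∫ w(y, x) f(y, c y)(x) dx dy`. -/
def sigmaForm (A : Subalgebra ℝ (Euc m →ᵇ ℝ)) [SFinite ν] [Fact (1 ≤ p)] [Fact (1 ≤ q)]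
    [p.HolderConjugate q] (hp' : p ≠ ∞) (hq' : q ≠ ∞)
    {w : Euc m × X → ℝ} (hw : MemLp w p (μ.prod ν)) (c : ℝ) :
    Lp (vecAlgebra A (Lp ℝ q ν)) q μ →L[ℝ] ℝ :=
  LinearMap.mkContinuous
    { toFun := fun f => ∫ y, ∫ x, w (y, x) * diagTrace c f y x ∂ν ∂μ
      map_add' := fun f g =>
        (integral_congr_ae (ae_integral_mul_diagTrace_add hp' hw c (Lp.coeFn_add f g))).trans (integral_add
          (integrable_integral_mul_Lp hp' hq' hw (memLp_diagTrace c (Lp.memLp f)))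
          (integrable_integral_mul_Lp hp' hq' hw (memLp_diagTrace c (Lp.memLp g))))
      map_smul' := fun a f =>
        (integral_congr_ae (ae_integral_mul_diagTrace_smul hp' hw c a (Lp.coeFn_smul a f))).trans
          (integral_const_mul _ _) }
    (eLpNorm w p (μ.prod ν)).toReal fun f => by
      refine (norm_integral_mul_Lp_le hp' hq' hw (memLp_diagTrace c (Lp.memLp f))).trans ?_
      gcongr
      rw [Lp.norm_def]
      exact ENNReal.toReal_mono (Lp.eLpNorm_ne_top f)
        (eLpNorm_mono fun y => norm_diagTrace_le c f y)

lemma norm_sigmaForm_le [SFinite ν] [Fact (1 ≤ p)] [Fact (1 ≤ q)] [p.HolderConjugate q] (hp' : p ≠ ∞) (hq' : q ≠ ∞)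
    {w : Euc m × X → ℝ} (hw : MemLp w p (μ.prod ν)) (c : ℝ) :
    ‖sigmaForm A hp' hq' hw c‖ ≤ (eLpNorm w p (μ.prod ν)).toReal :=
  LinearMap.mkContinuous_norm_le _ ENNReal.toReal_nonneg _

/-- The integrals of rescaled simple functions converge to the integral of the mean value. -/
lemma tendsto_integral_simpleFunc_inv_smul (hA : IsAlgebraWithMeanValue A) [IsFiniteMeasure ν]
    {G : Set (Euc m)} (hG : MeasurableSet G) (hG' : volume G ≠ ∞)
    (s : SimpleFunc (Euc m) (SimpleFunc X (Alg A))) :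
    Tendsto (fun ε : ℝ => ∫ y in G, ∫ x, (s y x).fn (ε⁻¹ • y) ∂ν) (𝓝[>] 0)
      (𝓝 (∫ y in G, ∫ x, algMean hA (s y x) ∂ν)) := by
  classical
  have : IsFiniteMeasure (volume.restrict G) := ⟨by
    rw [Measure.restrict_apply_univ]; exact hG'.lt_top⟩
  -- Integrating in x first leaves an A-valued simple function of y, that is, finitely many a(y/ε)
  -- each multiplied by the indicator of a set of finite measure; the weak-* convergence applies to
  -- each.
  set s' : SimpleFunc (Euc m) (Alg A) := s.map (simpleInt ν)
  have e1 : ∀ y z, ∫ x, (s y x).fn z ∂ν = (s' y).fn z := fun y z =>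
    (linearMap_simpleInt ν (algEval A z).toLinearMap (s y)).symm
  have e2 : ∀ y, ∫ x, algMean hA (s y x) ∂ν = algMean hA (s' y) := fun y =>
    (linearMap_simpleInt ν (algMean hA) (s y)).symm
  simp only [e1, e2]
  rw [← linearMap_simpleInt, simpleInt, map_sum]
  set φ : Alg A → Euc m → ℝ := fun a => (G ∩ s' ⁻¹' {a}).indicator fun _ => 1
  have hφ : ∀ a, Integrable (φ a) := fun a =>
    (integrable_indicator_iff (hG.inter (s'.measurableSet_fiber a))).2
      (integrableOn_const (measure_ne_top_of_subset Set.inter_subset_left hG'))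
  have e3 : ∀ (a : Alg A), ∫ y, φ a y = (volume.restrict G).real (s' ⁻¹' {a}) := fun a => by
    rw [integral_indicator_const _ (hG.inter (s'.measurableSet_fiber a)), smul_eq_mul, mul_one,
      Measure.real, Measure.real, Measure.restrict_apply (s'.measurableSet_fiber a), Set.inter_comm]
  have e4 : ∀ c : ℝ, ∫ y in G, (s' y).fn (c • y)
      = ∑ a ∈ s'.range, ∫ y, a.fn (c • y) * φ a y := fun c => by
    rw [← integral_finsetSum, ← integral_indicator hG]
    · refine integral_congr_ae (Eventually.of_forall fun y => ?_)
      by_cases hy : y ∈ G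
      · dsimp only
        rw [Set.indicator_of_mem hy, Finset.sum_eq_single_of_mem (s' y) (s'.mem_range_self y)
          fun b _ hb => by
            simp only [φ]
            rw [Set.indicator_of_notMem (fun hx => hb hx.2.symm), mul_zero]]
        simp only [φ]
        rw [Set.indicator_of_mem (show y ∈ G ∩ s' ⁻¹' {s' y} from ⟨hy, rfl⟩), mul_one]
      · dsimp only
        rw [Set.indicator_of_notMem hy]
        refine (Finset.sum_eq_zero fun b _ => ?_).symm
        simp only [φ]
        rw [Set.indicator_of_notMem (fun hx => hy hx.1), mul_zero]
    · intro a _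
      exact (hφ a).bdd_mul (c := ‖a.fn‖)
        (a.fn.continuous.comp (continuous_const_smul c)).aestronglyMeasurable
        (Eventually.of_forall fun y => a.fn.norm_coe_le_norm _)
  simp only [e4]
  refine tendsto_finsetSum _ fun a _ => ?_
  have h := tendsto_integral_comp_inv_smul hA a (hφ a)
  rw [e3] at h
  rwa [map_smul, smul_eq_mul, mul_comm]

end SigmaForm

/-! ### Density of the simple functions -/

section Density

lemma submodule_eq_top_of_indicatorConstLp_mem {X F : Type*} [MeasurableSpace X]
    [NormedAddCommGroup F] [NormedSpace ℝ F] {r : ℝ≥0∞} [hr : Fact (1 ≤ r)] (hr' : r ≠ ∞)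
    {ν : Measure X} [IsFiniteMeasure ν] {W : Submodule ℝ (Lp F r ν)}
    (hW : IsClosed (W : Set (Lp F r ν)))
    (h : ∀ (c : F) (s : Set X) (hs : MeasurableSet s),
      indicatorConstLp r hs (measure_ne_top ν s) c ∈ W) : W = ⊤ := by
  refine (Submodule.eq_top_iff').2 fun f => ?_
  refine Lp.induction hr' (motive := fun f => f ∈ W) (fun c s hs hμs => ?_) ?_ hW f
  · rw [Lp.simpleFunc.coe_indicatorConst]
    exact h c s hs
  · intro f g hf hg _ hfW hgW
    exact W.add_mem hfW hgW

lemma simpleLp_piecewise {X E F : Type*} [MeasurableSpace X] [AddCommGroup E] [Module ℝ E]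
    [NormedAddCommGroup F] [NormedSpace ℝ F] (r : ℝ≥0∞) (ν : Measure X) [IsFiniteMeasure ν]
    (T : E →ₗ[ℝ] F) (e : E) {s : Set X} (hs : MeasurableSet s) :
    simpleLp r ν T (SimpleFunc.piecewise s hs (SimpleFunc.const X e) (SimpleFunc.const X 0))
      = indicatorConstLp r hs (measure_ne_top ν s) (T e) := by
  classical
  refine Lp.ext ?_
  filter_upwards [coeFn_simpleLp r ν T (SimpleFunc.piecewise s hs (SimpleFunc.const X e)
    (SimpleFunc.const X 0)), indicatorConstLp_coeFn (p := r) (hs := hs)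
      (hμs := measure_ne_top ν s) (c := T e)] with x h1 h2
  rw [h1, h2]
  by_cases hx : x ∈ s
  · simp [hx]
  · simp [hx]

/-- The simple function equal to a constant on a set and to zero elsewhere. -/
def simpleIndicator {X : Type*} [MeasurableSpace X] (F : Type*) [AddCommGroup F] [Module ℝ F]
    {s : Set X} (hs : MeasurableSet s) : F →ₗ[ℝ] SimpleFunc X F where
  toFun c := SimpleFunc.piecewise s hs (SimpleFunc.const X c) (SimpleFunc.const X 0)
  map_add' c c' := SimpleFunc.ext fun x => by
    classical
    by_cases hx : x ∈ s <;> simp [hx]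
  map_smul' a c := SimpleFunc.ext fun x => by
    classical
    by_cases hx : x ∈ s <;> simp [hx]

/-- The class of the indicator of a set, as a function of its constant value. -/
def indicatorConstL {X : Type*} [MeasurableSpace X] (F : Type*) [NormedAddCommGroup F]
    [NormedSpace ℝ F] (r : ℝ≥0∞) [Fact (1 ≤ r)] (ν : Measure X) [IsFiniteMeasure ν] {s : Set X}
    (hs : MeasurableSet s) : F →L[ℝ] Lp F r ν :=
  LinearMap.mkContinuous (simpleLp r ν (LinearMap.id (R := ℝ) (M := F)) ∘ₗ simpleIndicator F hs)
    (ν.real s ^ (1 / r.toReal)) fun c => by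
      refine (congrArg norm (simpleLp_piecewise r ν LinearMap.id c hs)).trans_le ?_
      rw [mul_comm]
      exact norm_indicatorConstLp_le

lemma indicatorConstL_apply {X : Type*} [MeasurableSpace X] {F : Type*} [NormedAddCommGroup F]
    [NormedSpace ℝ F] (r : ℝ≥0∞) [Fact (1 ≤ r)] (ν : Measure X) [IsFiniteMeasure ν] {s : Set X}
    (hs : MeasurableSet s) (c : F) :
    indicatorConstL F r ν hs c = indicatorConstLp r hs (measure_ne_top ν s) c :=
  simpleLp_piecewise r ν (LinearMap.id (R := ℝ) (M := F)) c hs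

/-- For a fixed set, the values c whose indicator function lies in the closure form a closed
subspace. It contains the range of T, hence everything, and indicators span a dense subspace of L^r.
-/
theorem range_simpleLp_dense {X E F : Type*} [MeasurableSpace X] [AddCommGroup E] [Module ℝ E]
    [NormedAddCommGroup F] [NormedSpace ℝ F] {r : ℝ≥0∞} [Fact (1 ≤ r)] (hr' : r ≠ ∞)
    (ν : Measure X) [IsFiniteMeasure ν] {T : E →ₗ[ℝ] F}
    (hT : (LinearMap.range T).topologicalClosure = ⊤) :
    (LinearMap.range (simpleLp r ν T)).topologicalClosure = ⊤ := by
  set W := (LinearMap.range (simpleLp r ν T)).topologicalClosure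
  have hW : IsClosed (W : Set (Lp F r ν)) := Submodule.isClosed_topologicalClosure _
  refine submodule_eq_top_of_indicatorConstLp_mem hr' hW fun c s hs => ?_
  have h1 : (LinearMap.range T).topologicalClosure
      ≤ W.comap (indicatorConstL F r ν hs).toLinearMap := by
    refine Submodule.topologicalClosure_minimal _ ?_
      (hW.preimage (indicatorConstL F r ν hs).continuous)
    rintro _ ⟨e, rfl⟩
    rw [Submodule.mem_comap, ContinuousLinearMap.coe_coe, indicatorConstL_apply,
      ← simpleLp_piecewise]
    exact Submodule.le_topologicalClosure _ ⟨_, rfl⟩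
  rw [hT] at h1
  have h2 := h1 (Submodule.mem_top (x := c))
  rwa [Submodule.mem_comap, ContinuousLinearMap.coe_coe, indicatorConstL_apply] at h2

variable {m : ℕ} {A : Subalgebra ℝ (Euc m →ᵇ ℝ)}

/-- The map `v ↦ a ⊗ v`. -/
def vecAlgebraTensorL (F : Type*) [NormedAddCommGroup F] [NormedSpace ℝ F] (a : Alg A) :
    F →L[ℝ] vecAlgebra A F :=
  LinearMap.mkContinuous
    { toFun := fun v => vecAlgebraTensor a v
      map_add' := fun v v' => Subtype.ext <| BoundedContinuousFunction.ext fun y =>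
        smul_add (a.fn y) v v'
      map_smul' := fun c v => Subtype.ext <| BoundedContinuousFunction.ext fun y =>
        smul_comm (a.fn y) c v }
    ‖a.fn‖ fun v => (BoundedContinuousFunction.norm_le (by positivity)).2 fun y =>
      (norm_smul_le _ _).trans (mul_le_mul_of_nonneg_right (a.fn.norm_coe_le_norm y)
        (norm_nonneg v))

lemma vecAlgebraTensorL_apply {F : Type*} [NormedAddCommGroup F] [NormedSpace ℝ F] (a : Alg A)
    (v : F) : vecAlgebraTensorL F a v = vecAlgebraTensor a v := rfl

lemma vecAlgebra_submodule_eq_top {F : Type*} [NormedAddCommGroup F] [NormedSpace ℝ F]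
    {K : Submodule ℝ (vecAlgebra A F)} (hK : IsClosed (K : Set (vecAlgebra A F)))
    (h : ∀ (a : Alg A) (v : F), vecAlgebraTensor a v ∈ K) : K = ⊤ := by
  have hspan : ∀ g (hg : g ∈ Submodule.span ℝ {g : Euc m →ᵇ F | ∃ a ∈ A, ∃ v : F,
      ∀ y, g y = a y • v}), (⟨g, Submodule.le_topologicalClosure _ hg⟩ : vecAlgebra A F) ∈ K := by
    intro g hg
    induction hg using Submodule.span_induction with
    | mem g hg =>
      obtain ⟨a, ha, v, hv⟩ := hg
      have := h ⟨a, ha⟩ v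
      convert this using 1
      exact Subtype.ext (BoundedContinuousFunction.ext hv)
    | zero => exact K.zero_mem
    | add g g' _ _ h1 h2 => exact K.add_mem h1 h2
    | smul c g _ h1 => exact K.smul_mem c h1
  refine (Submodule.eq_top_iff').2 fun c => hK.closure_subset
    (Metric.mem_closure_iff.2 fun η hη => ?_)
  obtain ⟨g, hg, hd⟩ := Metric.mem_closure_iff.1 c.2 η hη
  exact ⟨_, hspan g hg, hd⟩

lemma simpleEmb_piecewise {X : Type*} [MeasurableSpace X] (ν : Measure X) [IsFiniteMeasure ν]
    {q : ℝ≥0∞} [Fact (1 ≤ q)] (a : Alg A) (c : ℝ) {s : Set X} (hs : MeasurableSet s) :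
    simpleEmb A q ν (SimpleFunc.piecewise s hs (SimpleFunc.const X (c • a)) (SimpleFunc.const X 0))
      = vecAlgebraTensor a (indicatorConstLp q hs (measure_ne_top ν s) c) := by
  refine Subtype.ext (BoundedContinuousFunction.ext fun y => ?_)
  rw [simpleEmb_apply, simpleLp_piecewise, vecAlgebraTensor_apply]
  have h := (indicatorConstL ℝ q ν hs).map_smul (a.fn y) c
  rw [indicatorConstL_apply, indicatorConstL_apply] at h
  rw [← h, smul_eq_mul, mul_comm]
  rfl

/-- For fixed a, the v whose tensor with a lies in the closure form a closed subspace of L^q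
containing all indicators. So all pure tensors are reached, and these generate the vector-valued
algebra. -/
theorem range_simpleEmb_dense {X : Type*} [MeasurableSpace X] (ν : Measure X) [IsFiniteMeasure ν]
    {q : ℝ≥0∞} [Fact (1 ≤ q)] (hq' : q ≠ ∞) :
    (LinearMap.range (simpleEmb A q ν)).topologicalClosure = ⊤ := by
  set W := (LinearMap.range (simpleEmb A q ν)).topologicalClosure
  have hW : IsClosed (W : Set (vecAlgebra A (Lp ℝ q ν))) := Submodule.isClosed_topologicalClosure _
  refine vecAlgebra_submodule_eq_top hW fun a v => ?_
  have h : W.comap (vecAlgebraTensorL (Lp ℝ q ν) a).toLinearMap = ⊤ := by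
    refine submodule_eq_top_of_indicatorConstLp_mem hq'
      (hW.preimage (vecAlgebraTensorL (Lp ℝ q ν) a).continuous) fun c s hs => ?_
    rw [Submodule.mem_comap, ContinuousLinearMap.coe_coe, vecAlgebraTensorL_apply,
      ← simpleEmb_piecewise]
    exact Submodule.le_topologicalClosure _ ⟨_, rfl⟩
  exact (Submodule.eq_top_iff').1 h v

/-- Uniformly bounded linear forms which converge to zero on a dense subspace converge to zero
everywhere. -/
lemma tendsto_zero_of_dense {Z : Type*} [NormedAddCommGroup Z] [NormedSpace ℝ Z]
    {T : ℕ → Z →L[ℝ] ℝ} {K : ℝ} (hT : ∀ n, ‖T n‖ ≤ K) {D : Submodule ℝ Z}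
    (hD : D.topologicalClosure = ⊤) (h : ∀ f ∈ D, Tendsto (fun n => T n f) atTop (𝓝 0)) (f : Z) :
    Tendsto (fun n => T n f) atTop (𝓝 0) := by
  have hK : 0 ≤ K := (norm_nonneg _).trans (hT 0)
  have hf : f ∈ closure (D : Set Z) := by
    rw [← Submodule.topologicalClosure_coe, hD]
    trivial
  rw [Metric.tendsto_nhds]
  intro η hη
  obtain ⟨g, hg, hd⟩ := Metric.mem_closure_iff.1 hf (η / (2 * (K + 1))) (by positivity)
  filter_upwards [Metric.tendsto_nhds.1 (h g hg) (η / 2) (by positivity)] with n hn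
  rw [dist_zero_right] at hn ⊢
  have h1 : ‖T n (f - g)‖ ≤ η / 2 := by
    calc ‖T n (f - g)‖ ≤ K * ‖f - g‖ := (T n).le_of_opNorm_le (hT n) _
      _ ≤ (K + 1) * (η / (2 * (K + 1))) := by
          rw [dist_eq_norm] at hd
          gcongr
          linarith
      _ = η / 2 := by field_simp
  have h2 : T n f = T n (f - g) + T n g := by rw [map_sub, sub_add_cancel]
  rw [h2]
  exact (norm_add_le _ _).trans_lt (by linarith)

end Density

/-! ### Calculus with simple functions of two variables -/

section Calculus

variable {m : ℕ} {A : Subalgebra ℝ (Euc m →ᵇ ℝ)}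

/-- Simple functions of two variables with values in the algebra. -/
abbrev BiSimple (A : Subalgebra ℝ (Euc m →ᵇ ℝ)) (Y X : Type*) [MeasurableSpace Y]
    [MeasurableSpace X] : Type _ := SimpleFunc Y (SimpleFunc X (Alg A))

variable {Y X : Type*} [MeasurableSpace Y] [MeasurableSpace X] (μ : Measure Y) [IsFiniteMeasure μ]
  (ν : Measure X) [IsFiniteMeasure ν] (hA : IsAlgebraWithMeanValue A)

/-- Composition of a simple function of two variables with a continuous function. -/
def biComp (Φ : C(ℝ, ℝ)) (s : BiSimple A Y X) : BiSimple A Y X :=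
  s.map fun t => t.map (algComp hA Φ)

lemma fn_biComp (Φ : C(ℝ, ℝ)) (s : BiSimple A Y X) (y : Y) (x : X) (z : Euc m) :
    (biComp hA Φ s y x).fn z = Φ ((s y x).fn z) :=
  algComp_apply hA Φ _ z

lemma integrable_integral_algMean (ν : Measure X) (s : BiSimple A Y X) :
    Integrable (fun y => ∫ x, algMean hA (s y x) ∂ν) μ :=
  integrable_simpleFunc_comp μ s fun t => ∫ x, algMean hA (t x) ∂ν

/-- The integral of the mean value. -/
def meanInt : BiSimple A Y X →ₗ[ℝ] ℝ where
  toFun s := ∫ y, ∫ x, algMean hA (s y x) ∂ν ∂μ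
  map_add' s s' := by
    rw [← integral_add (integrable_integral_algMean μ hA ν s) (integrable_integral_algMean μ hA ν s')]
    refine integral_congr_ae (Eventually.of_forall fun y => ?_)
    dsimp only
    rw [← integral_add (integrable_simpleFunc_comp ν (s y) _)
      (integrable_simpleFunc_comp ν (s' y) _)]
    refine integral_congr_ae (Eventually.of_forall fun x => ?_)
    exact map_add (algMean hA) _ _
  map_smul' c s := by
    rw [RingHom.id_apply, smul_eq_mul, ← integral_const_mul]
    refine integral_congr_ae (Eventually.of_forall fun y => ?_)
    dsimp only
    rw [← integral_const_mul]
    refine integral_congr_ae (Eventually.of_forall fun x => ?_)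
    exact map_smul (algMean hA) _ _

lemma meanInt_apply (s : BiSimple A Y X) :
    meanInt μ ν hA s = ∫ y, ∫ x, algMean hA (s y x) ∂ν ∂μ := rfl

lemma meanInt_mono {s s' : BiSimple A Y X} (h : ∀ y x z, (s y x).fn z ≤ (s' y x).fn z) :
    meanInt μ ν hA s ≤ meanInt μ ν hA s' :=
  integral_mono (integrable_integral_algMean μ hA ν s) (integrable_integral_algMean μ hA ν s')
    fun y => integral_mono (integrable_simpleFunc_comp ν (s y) _)
      (integrable_simpleFunc_comp ν (s' y) _) fun x => algMean_mono hA (h y x)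

lemma meanInt_congr {s s' : BiSimple A Y X} (h : ∀ y x z, (s y x).fn z = (s' y x).fn z) :
    meanInt μ ν hA s = meanInt μ ν hA s' :=
  le_antisymm (meanInt_mono μ ν hA fun y x z => (h y x z).le)
    (meanInt_mono μ ν hA fun y x z => (h y x z).ge)

lemma meanInt_nonneg {s : BiSimple A Y X} (h : ∀ y x z, 0 ≤ (s y x).fn z) :
    0 ≤ meanInt μ ν hA s := by
  have := meanInt_mono μ ν hA (s := 0) h
  rwa [map_zero] at this

/-- The functional `s ↦ r⁻¹ ∫ ∫ M(|s|^r)`. -/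
def powerEnergy (r : ℝ) (s : BiSimple A Y X) : ℝ := meanInt μ ν hA (biComp hA (absRpow r) s) / r

variable {r : ℝ}

/-- The duality map of the real line, as a bundled continuous function. -/
def dualityC (hr : 1 < r) : C(ℝ, ℝ) := ⟨dualityMap r, continuous_dualityMap hr⟩

lemma dualityC_apply (hr : 1 < r) (a : ℝ) : dualityC hr a = dualityMap r a := rfl

/-- The derivative of `powerEnergy`. -/
def energyDeriv (hr : 1 < r) (s : BiSimple A Y X) : BiSimple A Y X →ₗ[ℝ] ℝ where
  toFun t := meanInt μ ν hA (biComp hA (dualityC hr) s * t)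
  map_add' t t' := by rw [mul_add, map_add]
  map_smul' c t := by
    rw [RingHom.id_apply, ← map_smul]
    refine meanInt_congr μ ν hA fun y x z => ?_
    change (biComp hA (dualityC hr) s y x).fn z * (c * (t y x).fn z)
      = c * ((biComp hA (dualityC hr) s y x).fn z * (t y x).fn z)
    ring

lemma energyDeriv_apply (hr : 1 < r) (s t : BiSimple A Y X) :
    energyDeriv μ ν hA hr s t = meanInt μ ν hA (biComp hA (dualityC hr) s * t) := rfl

lemma powerEnergy_nonneg (hr : 1 < r) (s : BiSimple A Y X) : 0 ≤ powerEnergy μ ν hA r s := by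
  refine div_nonneg (meanInt_nonneg μ ν hA fun y x z => ?_) (by linarith)
  rw [fn_biComp, absRpow_apply (by linarith)]
  positivity

lemma powerEnergy_neg (s : BiSimple A Y X) : powerEnergy μ ν hA r (-s) = powerEnergy μ ν hA r s := by
  unfold powerEnergy
  congr 1
  refine meanInt_congr μ ν hA fun y x z => ?_
  rw [fn_biComp, fn_biComp]
  change |-(s y x).fn z| ^ (max r 0) = |(s y x).fn z| ^ (max r 0)
  rw [abs_neg]

lemma powerEnergy_zero (hr : 1 < r) : powerEnergy μ ν hA r (0 : BiSimple A Y X) = 0 := by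
  have h : meanInt μ ν hA (biComp hA (absRpow r) (0 : BiSimple A Y X)) = meanInt μ ν hA 0 := by
    refine meanInt_congr μ ν hA fun y x z => ?_
    rw [fn_biComp, absRpow_apply (by linarith)]
    change |(0 : ℝ)| ^ r = 0
    rw [abs_zero, Real.zero_rpow (by linarith)]
  rw [powerEnergy, h, map_zero, zero_div]

lemma meanInt_absRpow (hr : 1 < r) (s : BiSimple A Y X) :
    meanInt μ ν hA (biComp hA (absRpow r) s) = r * powerEnergy μ ν hA r s := by
  rw [powerEnergy, mul_div_cancel₀]
  linarith

/-- A crude bound through |a − b| ≤ 2 max(|a|, |b|). It keeps differences of points of bounded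
energy in a set of bounded energy, where they can serve as test directions. -/
lemma powerEnergy_sub_le (hr : 1 < r) (s t : BiSimple A Y X) :
    powerEnergy μ ν hA r (s - t) ≤ 2 ^ r * (powerEnergy μ ν hA r s + powerEnergy μ ν hA r t) := by
  have h0 : 0 ≤ r := by linarith
  have h : meanInt μ ν hA (biComp hA (absRpow r) (s - t)) ≤ meanInt μ ν hA ((2 : ℝ) ^ r •
      (biComp hA (absRpow r) s + biComp hA (absRpow r) t)) := by
    refine meanInt_mono μ ν hA fun y x z => ?_
    change _ ≤ 2 ^ r * ((biComp hA (absRpow r) s y x).fn z + (biComp hA (absRpow r) t y x).fn z)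
    rw [fn_biComp, fn_biComp, fn_biComp, absRpow_apply h0, absRpow_apply h0, absRpow_apply h0]
    change |(s y x).fn z - (t y x).fn z| ^ r ≤ _
    set a := (s y x).fn z
    set b := (t y x).fn z
    have h1 : |a - b| ≤ 2 * max |a| |b| := by
      have := abs_sub a b
      have := le_max_left |a| |b|
      have := le_max_right |a| |b|
      linarith
    have h2 : (max |a| |b|) ^ r ≤ |a| ^ r + |b| ^ r := by
      have ha : 0 ≤ |a| ^ r := by positivity
      have hb : 0 ≤ |b| ^ r := by positivity
      rcases max_choice |a| |b| with h | h <;> rw [h] <;> linarith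
    calc |a - b| ^ r ≤ (2 * max |a| |b|) ^ r := Real.rpow_le_rpow (abs_nonneg _) h1 h0
      _ = 2 ^ r * (max |a| |b|) ^ r := Real.mul_rpow (by norm_num) (by positivity)
      _ ≤ _ := by gcongr
  rw [map_smul, map_add, smul_eq_mul] at h
  simp only [meanInt_absRpow μ ν hA hr] at h
  have hr0 : 0 < r := by linarith
  refine le_of_mul_le_mul_left ?_ hr0
  linarith

/-- The scalar expansion is integrated pointwise; its step t depends on η alone, so the same t works
for all functions. -/
lemma exists_powerEnergy_smooth (hr : 1 < r) {η : ℝ} (hη : 0 < η) :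
    ∃ t > 0, ∀ x y : BiSimple A Y X, powerEnergy μ ν hA r (x + t • y)
      ≤ powerEnergy μ ν hA r x + t * energyDeriv μ ν hA hr x y
        + η * t * (powerEnergy μ ν hA r x + powerEnergy μ ν hA r y) := by
  have h0 : 0 ≤ r := by linarith
  have hr0 : 0 < r := by linarith
  obtain ⟨t, ht, hsm⟩ := exists_dualityMap_smooth hr (η := η / r) (by positivity)
  refine ⟨t, ht, fun u v => ?_⟩
  have h : meanInt μ ν hA ((1 / r) • biComp hA (absRpow r) (u + t • v)) ≤ meanInt μ ν hA
      ((1 / r) • biComp hA (absRpow r) u + t • (biComp hA (dualityC hr) u * v)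
        + (η / r * t) • (biComp hA (absRpow r) u + biComp hA (absRpow r) v)) := by
    refine meanInt_mono μ ν hA fun y x z => ?_
    change 1 / r * (biComp hA (absRpow r) (u + t • v) y x).fn z
      ≤ 1 / r * (biComp hA (absRpow r) u y x).fn z
        + t * ((biComp hA (dualityC hr) u y x).fn z * (v y x).fn z)
        + η / r * t * ((biComp hA (absRpow r) u y x).fn z + (biComp hA (absRpow r) v y x).fn z)
    simp only [fn_biComp, absRpow_apply h0, dualityC_apply]
    change 1 / r * |(u y x).fn z + t * (v y x).fn z| ^ r ≤ _
    have := hsm ((u y x).fn z) ((v y x).fn z)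
    rw [one_div_mul_eq_div, one_div_mul_eq_div]
    exact this
  simp only [map_add, map_smul, smul_eq_mul, meanInt_absRpow μ ν hA hr] at h
  rw [← energyDeriv_apply] at h
  field_simp at h
  linarith

/-- Uniform strict monotonicity of the derivative of `powerEnergy`. -/
lemma exists_meanInt_dualityMap_sub_le {r' : ℝ} (h : r.HolderConjugate r') {η : ℝ} (hη : 0 < η) :
    ∃ K ≥ 0, ∀ u v : BiSimple A Y X,
      meanInt μ ν hA (biComp hA (absRpow r')
        (biComp hA (dualityC h.lt) u - biComp hA (dualityC h.lt) v))
      ≤ η * (powerEnergy μ ν hA r u + powerEnergy μ ν hA r v)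
        + K * (energyDeriv μ ν hA h.lt u (u - v) - energyDeriv μ ν hA h.lt v (u - v)) := by
  have h0 : 0 ≤ r := h.nonneg
  have h0' : 0 ≤ r' := h.symm.nonneg
  have hr0 : 0 < r := h.pos
  obtain ⟨K, hK0, hK⟩ := exists_dualityMap_sub_le h (η := η / r) (by positivity)
  refine ⟨K, hK0, fun u v => ?_⟩
  have hle : meanInt μ ν hA (biComp hA (absRpow r')
        (biComp hA (dualityC h.lt) u - biComp hA (dualityC h.lt) v)) ≤ meanInt μ ν hA
      ((η / r) • (biComp hA (absRpow r) u + biComp hA (absRpow r) v)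
        + K • (biComp hA (dualityC h.lt) u * (u - v) - biComp hA (dualityC h.lt) v * (u - v))) := by
    refine meanInt_mono μ ν hA fun y x z => ?_
    rw [fn_biComp, absRpow_apply h0']
    change |(biComp hA (dualityC h.lt) u y x).fn z - (biComp hA (dualityC h.lt) v y x).fn z| ^ r'
      ≤ η / r * ((biComp hA (absRpow r) u y x).fn z + (biComp hA (absRpow r) v y x).fn z)
        + K * ((biComp hA (dualityC h.lt) u y x).fn z * ((u y x).fn z - (v y x).fn z)
          - (biComp hA (dualityC h.lt) v y x).fn z * ((u y x).fn z - (v y x).fn z))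
    simp only [fn_biComp, absRpow_apply h0, dualityC_apply]
    rw [← sub_mul]
    exact hK _ _
  simp only [map_add, map_smul, map_sub, smul_eq_mul, meanInt_absRpow μ ν hA h.lt] at hle
  rw [← energyDeriv_apply, ← energyDeriv_apply] at hle
  refine hle.trans (le_of_eq ?_)
  field_simp

end Calculus

/-! ### Embeddings of simple functions of two variables -/

section BiEmbedding

variable {m : ℕ} {A : Subalgebra ℝ (Euc m →ᵇ ℝ)} {Y X : Type*} [MeasurableSpace Y]
  [MeasurableSpace X] (μ : Measure Y) [IsFiniteMeasure μ] (ν : Measure X) [IsFiniteMeasure ν]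
  (hA : IsAlgebraWithMeanValue A) {p q : ℝ≥0∞} [hp : Fact (1 ≤ p)] [Fact (1 ≤ q)]

/-- Simple functions of two variables as elements of `L^p(Y; 𝓑_A^p(L^p(X)))`. -/
def biBes (A : Subalgebra ℝ (Euc m →ᵇ ℝ)) (p : ℝ≥0∞) [Fact (1 ≤ p)] :
    BiSimple A Y X →ₗ[ℝ] Lp (Besicovitch A p (Lp ℝ p ν)) p μ :=
  simpleLp p μ (vecAlgebraToBes A p (Lp ℝ p ν) ∘ₗ simpleEmb A p ν)

lemma norm_rpow_biBes (hp' : p ≠ ∞) (s : BiSimple A Y X) :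
    ‖biBes μ ν A p s‖ ^ p.toReal = meanInt μ ν hA (biComp hA (absRpow p.toReal) s) := by
  refine (norm_rpow_simpleLp hp.out hp' μ _ s).trans ?_
  exact integral_congr_ae (Eventually.of_forall fun y =>
    norm_rpow_vecAlgebraToBes_simpleEmb hA hp' ν (s y))

/-- The duality between `L^p(Y; 𝓑_A^p(L^p(X)))` and `L^q(Y; A(L^q(X)))`. -/
def sigmaPairing [p.HolderConjugate q] : Lp (Besicovitch A p (Lp ℝ p ν)) p μ →L[ℝ]
    Lp (vecAlgebra A (Lp ℝ q ν)) q μ →L[ℝ] ℝ :=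
  (meanPairing hA ((ContinuousLinearMap.mul ℝ ℝ).lpPairing ν p q)).lpPairing μ p q

lemma integral_bilin_simpleLp {E F₁ F₂ : Type*} [AddCommGroup E] [Module ℝ E]
    [NormedAddCommGroup F₁] [NormedSpace ℝ F₁] [NormedAddCommGroup F₂] [NormedSpace ℝ F₂]
    [p.HolderConjugate q] (B : F₁ →L[ℝ] F₂ →L[ℝ] ℝ) (T₁ : E →ₗ[ℝ] F₁) (T₂ : E →ₗ[ℝ] F₂)
    (s t : SimpleFunc Y E) :
    B.lpPairing μ p q (simpleLp p μ T₁ s) (simpleLp q μ T₂ t)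
      = ∫ y, B (T₁ (s y)) (T₂ (t y)) ∂μ := by
  rw [ContinuousLinearMap.lpPairing_eq_integral]
  refine integral_congr_ae ?_
  filter_upwards [coeFn_simpleLp p μ T₁ s, coeFn_simpleLp q μ T₂ t] with y h1 h2
  rw [h1, h2]

/-- With the duality map of s in the first slot this is the derivative of the energy at s, so such
derivatives are represented by elements of the limit space. -/
lemma sigmaPairing_biBes [p.HolderConjugate q] (s t : BiSimple A Y X) :
    sigmaPairing μ ν hA (biBes μ ν A p s) (simpleLp q μ (simpleEmb A q ν) t)
      = meanInt μ ν hA (s * t) := by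
  refine (integral_bilin_simpleLp μ
    (meanPairing hA ((ContinuousLinearMap.mul ℝ ℝ).lpPairing ν p q)) _ _ s t).trans ?_
  exact integral_congr_ae (Eventually.of_forall fun y => meanPairing_simpleEmb hA ν (s y) (t y))

end BiEmbedding

/-! ### Sequential compactness -/

section Compactness

variable {m : ℕ} {A : Subalgebra ℝ (Euc m →ᵇ ℝ)} {X : Type*} [MeasurableSpace X]
  {ν : Measure X} [IsFiniteMeasure ν] {p q : ℝ≥0∞} [hp : Fact (1 ≤ p)]

lemma toReal_eLpNorm_rpow [hq : Fact (1 ≤ q)] {Y F : Type*} [MeasurableSpace Y] [NormedAddCommGroup F] {μ : Measure Y}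
    (hq' : q ≠ ∞) {h : Y → F} (hh : MemLp h q μ) :
    (eLpNorm h q μ).toReal ^ q.toReal = ∫ y, ‖h y‖ ^ q.toReal ∂μ := by
  rw [← Lp.norm_toLp h hh, norm_rpow_Lp hq.out hq']
  refine integral_congr_ae ?_
  filter_upwards [hh.coeFn_toLp] with y hy using by rw [hy]

lemma toReal_eLpNorm_diagTrace_rpow [hq : Fact (1 ≤ q)] (hA : IsAlgebraWithMeanValue A) (hq' : q ≠ ∞)
    {μ : Measure (Euc m)} (s : BiSimple A (Euc m) X) (c : ℝ)
    {f : Euc m → vecAlgebra A (Lp ℝ q ν)} (hf : MemLp f q μ)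
    (hfs : f =ᵐ[μ] fun y => simpleEmb A q ν (s y)) :
    (eLpNorm (diagTrace c f) q μ).toReal ^ q.toReal
      = ∫ y, ∫ x, (biComp hA (absRpow q.toReal) s y x).fn (c • y) ∂ν ∂μ := by
  rw [toReal_eLpNorm_rpow hq' (memLp_diagTrace c hf)]
  refine integral_congr_ae ?_
  filter_upwards [hfs] with y hy
  rw [diagTrace, hy, simpleEmb_apply, norm_rpow_simpleLp hq.out hq']
  refine integral_congr_ae (Eventually.of_forall fun x => ?_)
  dsimp only
  rw [fn_biComp, absRpow_apply ENNReal.toReal_nonneg]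
  rfl

/-- The factor 4 is moved from N to C so that the power of N enters with coefficient 1/(4r), half of
the 1/(2r) that half the energy would allow; 4^r ≥ 4 because r > 1. -/
lemma young_bound {r r' C N : ℝ} (h : r.HolderConjugate r') (hN : 0 ≤ N) (hC : 0 ≤ C) :
    C * N ≤ (C * 4) ^ r' / r' + N ^ r / (4 * r) := by
  have h4 : (N / 4) ^ r ≤ N ^ r / 4 := by
    rw [Real.div_rpow hN (by norm_num)]
    refine div_le_div_of_nonneg_left (by positivity) (by norm_num) ?_
    exact Real.self_le_rpow_of_one_le (by norm_num) h.lt.le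
  have hy := Real.young_inequality_of_nonneg (a := N / 4) (b := C * 4) (by positivity)
    (by positivity) h
  have h5 : (N / 4) ^ r / r ≤ N ^ r / 4 / r := div_le_div_of_nonneg_right h4 h.nonneg
  rw [div_div] at h5
  linarith

variable {G : Set (Euc m)}

/-- The bound involves the L^q norm of the trace y ↦ s(y, cy), not the sup norm in the oscillating
variable. Only the former converges to the mean-value energy as c grows. -/
lemma exists_norm_sigmaForm_simpleLp_le [hq : Fact (1 ≤ q)] (hA : IsAlgebraWithMeanValue A) [p.HolderConjugate q]
    (hp' : p ≠ ∞) (hq' : q ≠ ∞) {μ : Measure (Euc m)} [IsFiniteMeasure μ] {w : Euc m × X → ℝ}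
    (hw : MemLp w p (μ.prod ν)) (c : ℝ) (s : BiSimple A (Euc m) X) :
    ∃ N : ℝ, 0 ≤ N ∧
      ‖sigmaForm A hp' hq' hw c (simpleLp q μ (simpleEmb A q ν) s)‖
        ≤ (eLpNorm w p (μ.prod ν)).toReal * N ∧
      N ^ q.toReal = ∫ y, ∫ x, (biComp hA (absRpow q.toReal) s y x).fn (c • y) ∂ν ∂μ :=
  ⟨_, ENNReal.toReal_nonneg, norm_integral_mul_Lp_le hp' hq' hw (memLp_diagTrace c (Lp.memLp _)),
    toReal_eLpNorm_diagTrace_rpow hA hq' s c (Lp.memLp _) (coeFn_simpleLp q μ _ s)⟩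

/-- The margin r allowed in the limit of I costs only 1/4 after division by 4r, and is absorbed by
the constant 1. -/
lemma eventually_le_of_young {r r' C Q : ℝ} (h : r.HolderConjugate r') (hQ : 0 ≤ Q)
    {a W I : ℕ → ℝ} (hW0 : ∀ n, 0 ≤ W n) (hW : ∀ n, W n ≤ C)
    (ha : ∀ n, ∃ N, 0 ≤ N ∧ ‖a n‖ ≤ W n * N ∧ N ^ r = I n) (hI : Tendsto I atTop (𝓝 (r * Q))) :
    ∀ᶠ n in atTop, a n ≤ ((C * 4) ^ r' / r' + 1) + Q / 2 := by
  have hr := h.pos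
  filter_upwards [hI.eventually_lt_const (show r * Q < r * Q + r by linarith)] with n hn
  obtain ⟨N, hN0, h1, hN⟩ := ha n
  have h2 := young_bound h hN0 ((hW0 n).trans (hW n))
  have h3 := (le_abs_self _).trans (h1.trans (mul_le_mul_of_nonneg_right (hW n) hN0))
  have h4 : N ^ r / (4 * r) ≤ Q / 4 + 1 / 4 := by
    rw [div_le_iff₀ (by positivity)]
    linarith
  linarith

/-- Asymptotic bound of the linear forms on simple functions. -/
lemma eventually_sigmaForm_le [hq : Fact (1 ≤ q)] (hA : IsAlgebraWithMeanValue A) [p.HolderConjugate q] (hp' : p ≠ ∞)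
    (hq' : q ≠ ∞) (hG : MeasurableSet G) [hfin : IsFiniteMeasure (volume.restrict G)]
    {ε : ℕ → ℝ} (hε : Tendsto ε atTop (𝓝[>] 0)) {w : ℕ → Euc m × X → ℝ}
    (hw : ∀ n, MemLp (w n) p ((volume.restrict G).prod ν)) {C : ℝ}
    (hwC : ∀ n, (eLpNorm (w n) p ((volume.restrict G).prod ν)).toReal ≤ C)
    (s : BiSimple A (Euc m) X) :
    ∀ᶠ n in atTop, sigmaForm A hp' hq' (hw n) (ε n)⁻¹
      (simpleLp q (volume.restrict G) (simpleEmb A q ν) s)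
        ≤ ((C * 4) ^ p.toReal / p.toReal + 1)
          + powerEnergy (volume.restrict G) ν hA q.toReal s / 2 := by
  have hqp : q.toReal.HolderConjugate p.toReal :=
    (ENNReal.HolderConjugate.toReal_of_ne_top hp' hq').symm
  have hG' : volume G ≠ ∞ := by
    have := measure_lt_top (volume.restrict G) Set.univ
    rw [Measure.restrict_apply_univ] at this
    exact this.ne
  have hlim := (tendsto_integral_simpleFunc_inv_smul (ν := ν) hA hG hG'
    (biComp hA (absRpow q.toReal) s)).comp hε
  rw [← meanInt_apply, meanInt_absRpow _ _ _ hqp.lt] at hlim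
  exact eventually_le_of_young hqp (powerEnergy_nonneg (volume.restrict G) ν hA hqp.lt s)
    (fun n => ENNReal.toReal_nonneg) hwC
    (fun n => exists_norm_sigmaForm_simpleLp_le hA hp' hq' (hw n) (ε n)⁻¹ s) hlim

/-- The derivatives of the energy along an asymptotically optimal sequence converge in
`L^p(Y; 𝓑_A^p(L^p(X)))`. -/
lemma cauchySeq_biBes_dualityMap (hA : IsAlgebraWithMeanValue A) {Y : Type*} [MeasurableSpace Y]
    (μ : Measure Y) [IsFiniteMeasure μ] (hp' : p ≠ ∞)
    (hqp : q.toReal.HolderConjugate p.toReal) {x : ℕ → BiSimple A Y X} {R : ℝ}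
    (hR : ∀ k, powerEnergy μ ν hA q.toReal (x k) ≤ R)
    (hx : ∀ R, ∀ η > 0, ∀ᶠ k in atTop, ∀ᶠ l in atTop, ∀ y, powerEnergy μ ν hA q.toReal y ≤ R →
      |energyDeriv μ ν hA hqp.lt (x k) y - energyDeriv μ ν hA hqp.lt (x l) y| ≤ η) :
    CauchySeq fun k => biBes μ ν A p (biComp hA (dualityC hqp.lt) (x k)) := by
  have hR0 : 0 ≤ R := (powerEnergy_nonneg μ ν hA hqp.lt (x 0)).trans (hR 0)
  have key : ∀ δ > 0, ∀ᶠ k in atTop, ∀ᶠ l in atTop,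
      ‖biBes μ ν A p (biComp hA (dualityC hqp.lt) (x k))
        - biBes μ ν A p (biComp hA (dualityC hqp.lt) (x l))‖ < δ := by
    intro δ hδ
    have hδp : 0 < δ ^ p.toReal := Real.rpow_pos_of_pos hδ _
    -- The two tolerances make the energy term at most δ^p/2 and the monotonicity term at most
    -- δ^p/4, together below δ^p. K is obtained first, as the second tolerance depends on it.
    obtain ⟨K, hK0, hK⟩ := exists_meanInt_dualityMap_sub_le (A := A) μ ν hA hqp
      (η := δ ^ p.toReal / (4 * (R + 1))) (by positivity)
    filter_upwards [hx (2 ^ q.toReal * (R + R)) (δ ^ p.toReal / (4 * (K + 1))) (by positivity)]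
      with k hk
    filter_upwards [hk] with l hkl
    have h1 := hkl (x k - x l) ((powerEnergy_sub_le μ ν hA hqp.lt _ _).trans (by
      gcongr
      · exact hR k
      · exact hR l))
    have h2 := hK (x k) (x l)
    rw [← norm_rpow_biBes μ ν hA hp', map_sub] at h2
    refine lt_of_not_ge fun hge => ?_
    have h3 := Real.rpow_le_rpow hδ.le hge hqp.symm.nonneg
    have h4 : δ ^ p.toReal / (4 * (R + 1)) * (powerEnergy μ ν hA q.toReal (x k)
        + powerEnergy μ ν hA q.toReal (x l)) ≤ δ ^ p.toReal / 2 := by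
      calc _ ≤ δ ^ p.toReal / (4 * (R + 1)) * (2 * (R + 1)) := by
            refine mul_le_mul_of_nonneg_left ?_ (by positivity)
            linarith [hR k, hR l]
        _ = _ := by field_simp; ring
    have h5 : K * (energyDeriv μ ν hA hqp.lt (x k) (x k - x l)
        - energyDeriv μ ν hA hqp.lt (x l) (x k - x l)) ≤ δ ^ p.toReal / 4 := by
      calc _ ≤ K * (δ ^ p.toReal / (4 * (K + 1))) :=
            mul_le_mul_of_nonneg_left ((le_abs_self _).trans h1) hK0
        _ ≤ (K + 1) * (δ ^ p.toReal / (4 * (K + 1))) := by gcongr; linarith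
        _ = _ := by field_simp
    linarith
  rw [Metric.cauchySeq_iff']
  intro δ hδ
  -- In `key` the threshold for l depends on k; comparing both terms with one fixed k removes this
  -- dependence.
  obtain ⟨k, hk⟩ := (key (δ / 2) (by positivity)).exists
  obtain ⟨N, hN⟩ := eventually_atTop.1 hk
  refine ⟨N, fun n hn => ?_⟩
  have h1 := hN n hn
  have h2 := hN N le_rfl
  rw [← dist_eq_norm] at h1 h2
  have := dist_triangle_left (biBes μ ν A p (biComp hA (dualityC hqp.lt) (x n)))
    (biBes μ ν A p (biComp hA (dualityC hqp.lt) (x N)))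
    (biBes μ ν A p (biComp hA (dualityC hqp.lt) (x k)))
  linarith

/-- Weak sequential compactness of bounded linear forms which are asymptotically dominated by a
smooth energy, with limits in a complete space in duality. -/
theorem exists_subseq_tendsto_of_energy {V Z U : Type*} [AddCommGroup V] [Module ℝ V]
    [NormedAddCommGroup Z] [NormedSpace ℝ Z] [NormedAddCommGroup U] [NormedSpace ℝ U]
    [CompleteSpace U] (S : ℕ → Z →L[ℝ] ℝ) {C : ℝ} (hS : ∀ n, ‖S n‖ ≤ C) (ι : V →ₗ[ℝ] Z)
    (hι : (LinearMap.range ι).topologicalClosure = ⊤) (β : U →L[ℝ] Z →L[ℝ] ℝ) (j : V → U)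
    (Q : V → ℝ) (J : V → V →ₗ[ℝ] ℝ) (hJ : ∀ x y, β (j x) (ι y) = J x y) (hQ0 : Q 0 = 0)
    (hQneg : ∀ x, Q (-x) = Q x) (hQ : ∀ x, 0 ≤ Q x)
    (hsmooth : ∀ η > 0, ∃ t > 0, ∀ x y, Q (x + t • y) ≤ Q x + t * J x y + η * t * (Q x + Q y))
    {B : ℝ} (hL : ∀ x, ∀ᶠ n in atTop, S n (ι x) ≤ B + Q x / 2)
    (hcauchy : ∀ (x : ℕ → V) (R : ℝ), (∀ k, Q (x k) ≤ R) → (∀ R, ∀ η > 0, ∀ᶠ k in atTop,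
      ∀ᶠ l in atTop, ∀ y, Q y ≤ R → |J (x k) y - J (x l) y| ≤ η) → CauchySeq fun k => j (x k)) :
    ∃ ψ : ℕ → ℕ, StrictMono ψ ∧ ∃ u₀ : U,
      ∀ f, Tendsto (fun n => S (ψ n) f) atTop (𝓝 (β u₀ f)) := by
  obtain ⟨ψ, hψ, x, ⟨R, hR⟩, hx⟩ := exists_subseq_asymptotic_derivative
    (fun n => (S n).toLinearMap ∘ₗ ι) Q J hQ0 hQneg hQ hsmooth B hL
  -- J(x k) y and J(x l) y are both compared with L (ψ n) y for one n chosen after k, l and y. The n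
  -- disappears from the conclusion, so its dependence on y is harmless.
  obtain ⟨u₀, hu₀⟩ := cauchySeq_tendsto_of_complete (hcauchy x R hR fun R η hη => by
    have hη2 := hx R (η / 2) (by positivity)
    filter_upwards [hη2] with k hk
    filter_upwards [hη2] with l hl y hy
    obtain ⟨n, h1, h2⟩ := ((hk y hy).and (hl y hy)).exists
    have := abs_sub_le (J (x k) y) (((S (ψ n)).toLinearMap ∘ₗ ι) y) (J (x l) y)
    rw [abs_sub_comm] at h1
    linarith)
  refine ⟨ψ, hψ, u₀, fun f => ?_⟩
  have hT : ∀ n, ‖S (ψ n) - β u₀‖ ≤ C + ‖β u₀‖ := fun n =>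
    (norm_sub_le _ _).trans (add_le_add (hS _) le_rfl)
  have h0 : ∀ g ∈ LinearMap.range ι, Tendsto (fun n => (S (ψ n) - β u₀) g) atTop (𝓝 0) := by
    rintro _ ⟨y, rfl⟩
    have hpair : Tendsto (fun k => J (x k) y) atTop (𝓝 (β u₀ (ι y))) :=
      (((β.flip (ι y)).continuous.tendsto u₀).comp hu₀).congr fun k => hJ _ y
    rw [Metric.tendsto_nhds]
    intro η hη
    -- One k serves both approximations: the forms along the subsequence by J(x k), and J(x k) y by
    -- its limit. Only then does n tend to infinity.
    obtain ⟨k, h1, h2⟩ := ((hx (Q y) (η / 2) (by positivity)).and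
      (Metric.tendsto_nhds.1 hpair (η / 2) (by positivity))).exists
    filter_upwards [h1 y le_rfl] with n hn
    rw [Real.dist_eq] at h2
    rw [dist_zero_right, Real.norm_eq_abs]
    have h3 := abs_sub_le (S (ψ n) (ι y)) (J (x k) y) (β u₀ (ι y))
    have h4 : |S (ψ n) (ι y) - J (x k) y| ≤ η / 2 := hn
    exact h3.trans_lt (by linarith)
  have h := (tendsto_zero_of_dense hT hι h0 f).add_const (β u₀ f)
  rw [zero_add] at h
  exact h.congr fun n => sub_add_cancel _ _

/-- The energy has the exponent q of the test functions; its duality map raises to the power q − 1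
and so lands in exponent p, that of the limit. -/
theorem exists_subseq_tendsto_sigmaForm [hq : Fact (1 ≤ q)] (hm : 1 ≤ m) (hA : IsAlgebraWithMeanValue A)
    [p.HolderConjugate q] (hp' : p ≠ ∞) (hq' : q ≠ ∞) (hG : MeasurableSet G)
    [hfin : IsFiniteMeasure (volume.restrict G)]
    {ε : ℕ → ℝ} (hε : Tendsto ε atTop (𝓝[>] 0)) {w : ℕ → Euc m × X → ℝ}
    (hw : ∀ n, MemLp (w n) p ((volume.restrict G).prod ν)) {C : ℝ}
    (hwC : ∀ n, (eLpNorm (w n) p ((volume.restrict G).prod ν)).toReal ≤ C) :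
    ∃ ψ : ℕ → ℕ, StrictMono ψ ∧ ∃ u₀ : Lp (Besicovitch A p (Lp ℝ p ν)) p (volume.restrict G),
      ∀ f : Lp (vecAlgebra A (Lp ℝ q ν)) q (volume.restrict G),
        Tendsto (fun n => sigmaForm A hp' hq' (hw (ψ n)) (ε (ψ n))⁻¹ f) atTop
          (𝓝 (sigmaPairing (volume.restrict G) ν hA u₀ f)) := by
  have hqp : q.toReal.HolderConjugate p.toReal :=
    (ENNReal.HolderConjugate.toReal_of_ne_top hp' hq').symm
  have := completeSpace_besicovitch hm A hp' (Lp ℝ p ν)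
  exact exists_subseq_tendsto_of_energy (V := BiSimple A (Euc m) X)
    (fun n => sigmaForm A hp' hq' (hw n) (ε n)⁻¹)
    (fun n => (norm_sigmaForm_le hp' hq' (hw n) _).trans (hwC n))
    (simpleLp q (volume.restrict G) (simpleEmb A q ν))
    (range_simpleLp_dense hq' (volume.restrict G) (range_simpleEmb_dense ν hq'))
    (sigmaPairing (volume.restrict G) ν hA)
    (fun x => biBes (volume.restrict G) ν A p (biComp hA (dualityC hqp.lt) x))
    (powerEnergy (volume.restrict G) ν hA q.toReal)
    (energyDeriv (volume.restrict G) ν hA hqp.lt)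
    (fun x y => sigmaPairing_biBes (volume.restrict G) ν hA _ y)
    (powerEnergy_zero (volume.restrict G) ν hA hqp.lt)
    (powerEnergy_neg (volume.restrict G) ν hA)
    (powerEnergy_nonneg (volume.restrict G) ν hA hqp.lt)
    (fun η hη => exists_powerEnergy_smooth (volume.restrict G) ν hA hqp.lt hη)
    (eventually_sigmaForm_le hA hp' hq' hG hε hw hwC)
    (fun x R hR hx => cauchySeq_biBes_dualityMap hA (volume.restrict G) hp' hqp hR hx)

end Compactness

/-! ### Rescaling of the thin domains -/

section Rescaling

variable {d₁ d₂ : ℕ} {G₁ : Set (Euc d₁)} {G₂ : Set (Euc d₂)}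

lemma map_smul_restrict {ε : ℝ} (hε : 0 < ε) (hG₂ : IsOpen G₂) :
    (volume.restrict G₂).map (fun ζ : Euc d₂ => ε • ζ)
      = ENNReal.ofReal ((ε ^ d₂)⁻¹) • volume.restrict (ε • G₂) := by
  have hm : MeasurableSet (ε • G₂) := (hG₂.smul₀ hε.ne').measurableSet
  have hpre : (fun ζ : Euc d₂ => ε • ζ) ⁻¹' (ε • G₂) = G₂ := by
    ext ζ
    exact Set.smul_mem_smul_set_iff₀ hε.ne' G₂ ζ
  have h := Measure.map_addHaar_smul (volume : Measure (Euc d₂)) hε.ne'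
  rw [finrank_euclideanSpace_fin, abs_of_pos (by positivity)] at h
  rw [← Measure.restrict_smul, ← h, Measure.restrict_map (measurable_const_smul ε) hm]
  rw [hpre]

lemma map_prod_smul_restrict {ε : ℝ} (hε : 0 < ε) (hG₂ : IsOpen G₂) :
    ((volume.restrict G₁).prod (volume.restrict G₂)).map
        (fun z : Euc d₁ × Euc d₂ => (z.1, ε • z.2))
      = ENNReal.ofReal ((ε ^ d₂)⁻¹) • volume.restrict (thinDomain G₁ G₂ ε) := by
  have h := Measure.map_prod_map (volume.restrict G₁) (volume.restrict G₂) measurable_id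
    (measurable_const_smul ε (α := Euc d₂))
  rw [Measure.map_id, map_smul_restrict hε hG₂, Measure.prod_smul_right,
    Measure.prod_restrict] at h
  exact h.symm

lemma measurable_thinRescale (ε : ℝ) :
    Measurable fun z : Euc d₁ × Euc d₂ => (z.1, ε • z.2) :=
  measurable_fst.prodMk (measurable_snd.const_smul ε)

lemma memLp_thinRescale {p : ℝ≥0∞} {ε : ℝ} (hε : 0 < ε) (hG₂ : IsOpen G₂)
    (u : Lp ℝ p (volume.restrict (thinDomain G₁ G₂ ε))) :
    MemLp (fun z : Euc d₁ × Euc d₂ => u (z.1, ε • z.2)) p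
      ((volume.restrict G₁).prod (volume.restrict G₂)) := by
  have h : MemLp u p (((volume.restrict G₁).prod (volume.restrict G₂)).map
      (fun z : Euc d₁ × Euc d₂ => (z.1, ε • z.2))) := by
    rw [map_prod_smul_restrict hε hG₂]
    exact (Lp.memLp u).smul_measure ENNReal.ofReal_ne_top
  exact (memLp_map_measure_iff h.1 (measurable_thinRescale ε).aemeasurable).1 h

/-- The Jacobian ε^{-d₂} of the scaling, raised to the power 1/p, is exactly the normalization in
the assumed bound. -/
lemma toReal_eLpNorm_thinRescale {p : ℝ≥0∞} (hp' : p ≠ ∞) {ε : ℝ} (hε : 0 < ε) (hG₂ : IsOpen G₂)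
    (u : Lp ℝ p (volume.restrict (thinDomain G₁ G₂ ε))) :
    (eLpNorm (fun z : Euc d₁ × Euc d₂ => u (z.1, ε • z.2)) p
      ((volume.restrict G₁).prod (volume.restrict G₂))).toReal
      = ε ^ (-(d₂ : ℝ) / p.toReal) * ‖u‖ := by
  have h1 : eLpNorm (fun z : Euc d₁ × Euc d₂ => u (z.1, ε • z.2)) p
      ((volume.restrict G₁).prod (volume.restrict G₂))
      = eLpNorm u p (((volume.restrict G₁).prod (volume.restrict G₂)).map
        (fun z : Euc d₁ × Euc d₂ => (z.1, ε • z.2))) :=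
    (eLpNorm_map_measure (Lp.stronglyMeasurable u).aestronglyMeasurable
      (measurable_thinRescale ε).aemeasurable).symm
  rw [h1, map_prod_smul_restrict hε hG₂, eLpNorm_smul_measure_of_ne_top hp', smul_eq_mul,
    ENNReal.toReal_mul, Lp.norm_def, ← ENNReal.toReal_rpow, ENNReal.toReal_ofReal (by positivity)]
  congr 1
  rw [← Real.rpow_natCast, ← Real.rpow_neg hε.le, ← Real.rpow_mul hε.le]
  congr 1
  rw [one_div, ENNReal.toReal_inv]
  rfl

/-- Change of variables in the integral over the thin domain. -/
lemma integral_thinRescale {ε : ℝ} (hε : 0 < ε) (u : Euc d₁ × Euc d₂ → ℝ)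
    (g : Euc d₁ → Euc d₂ → ℝ) :
    (ε ^ d₂)⁻¹ * ∫ x in G₁, ∫ z in ε • G₂, u (x, z) * g x (ε⁻¹ • z)
      = ∫ x in G₁, ∫ ζ in G₂, u (x, ε • ζ) * g x ζ := by
  rw [← integral_const_mul]
  refine integral_congr_ae (Eventually.of_forall fun x => ?_)
  -- The scaling formula needs no measurability, so arbitrary representatives of the test function
  -- for the various x are allowed.
  have h := Measure.setIntegral_comp_smul_of_pos (volume : Measure (Euc d₂))
    (fun z => u (x, z) * g x (ε⁻¹ • z)) G₂ hε
  rw [finrank_euclideanSpace_fin, smul_eq_mul] at h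
  dsimp only
  rw [← h]
  simp only [smul_smul, inv_mul_cancel₀ hε.ne', one_smul]

end Rescaling

end ThinSigma

end

/-! ### The theorem: transfer from the thin domains to the fixed product -/

theorem theorem1p1 {d₁ d₂ : ℕ} (hd₁ : 1 ≤ d₁) (hd₂ : 1 ≤ d₂)
    (G₁ : Set (Euc d₁)) (G₂ : Set (Euc d₂))
    (hG₁ : IsOpen G₁) (hG₁b : Bornology.IsBounded G₁)
    (hG₂ : IsOpen G₂) (hG₂b : Bornology.IsBounded G₂) (hG₂0 : (0 : Euc d₂) ∈ closure G₂)
    (A : Subalgebra ℝ (Euc d₁ →ᵇ ℝ)) (hA : IsAlgebraWithMeanValue A)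
    (p q : ℝ≥0∞) [Fact (1 ≤ p)] [Fact (1 ≤ q)] [p.HolderConjugate q] (hp₁ : 1 < p) (hp : p < ∞)
    (ε : ℕ → ℝ) (hε : ∀ n, 0 < ε n) (hε0 : Tendsto ε atTop (𝓝 0))
    (u : ∀ n, Lp ℝ p (volume.restrict (thinDomain G₁ G₂ (ε n))))
    (C : ℝ) (hu : ∀ n, ε n ^ (-(d₂ : ℝ) / p.toReal) * ‖u n‖ ≤ C) :
    ∃ φ : ℕ → ℕ, StrictMono φ ∧
      ∃ u₀ : Lp (Besicovitch A p (LpOn p G₂)) p (volume.restrict G₁),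
        WeakSigmaConverges A p q G₁ G₂ (fun k => ε (φ k)) (fun k => u (φ k)) u₀ := by
  have hp' : p ≠ ∞ := hp.ne
  -- The energy argument needs both exponents finite; q is finite because p > 1.
  have hq' : q ≠ ∞ := ((ENNReal.HolderConjugate.lt_top_iff_one_lt q p).2 hp₁).ne
  have hfin₁ : IsFiniteMeasure (volume.restrict G₁) :=
    ⟨by rw [Measure.restrict_apply_univ]; exact hG₁b.measure_lt_top⟩
  have hfin₂ : IsFiniteMeasure (volume.restrict G₂) :=
    ⟨by rw [Measure.restrict_apply_univ]; exact hG₂b.measure_lt_top⟩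
  have hε' : Tendsto ε atTop (𝓝[>] 0) :=
    tendsto_nhdsWithin_iff.2 ⟨hε0, Eventually.of_forall hε⟩
  exact (exists_subseq_tendsto_sigmaForm hd₁ hA hp' hq' hG₁.measurableSet hε'
    (fun n => memLp_thinRescale (hε n) hG₂ (u n))
    (fun n => (toReal_eLpNorm_thinRescale hp' (hε n) hG₂ (u n)).trans_le (hu n))).imp
    fun ψ h => h.imp_right fun h => h.imp fun u₀ h =>
      -- The limit is rewritten by replacing the abstract pairing with integrals of mean products,
      -- and the sequence by undoing the rescaling.
      fun f => Eq.subst (motive := fun l => Tendsto _ atTop (𝓝 l))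
        ((ContinuousLinearMap.lpPairing_eq_integral _ u₀ f).trans
          (integral_congr_ae (Eventually.of_forall fun x =>
            (integral_meanProduct hA (u₀ x) (f x)).symm)))
        ((h f).congr fun n => (integral_thinRescale (hε (ψ n)) (u (ψ n))
          fun x ζ => (f x).1 ((ε (ψ n))⁻¹ • x) ζ).symm)
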